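/- Proposition 8.9. Let $PP'$ and $QQ'$ ($P'\ne P$, $Q'\ne Q$) be disjoint closed rays in the plane with origins $P$ and $Q$, let $N=\mathbb R^2\setminus\{P,Q\}$, and let $X$ be a point on neither ray. A based closed polygonal line in $N$ with basepoint $X$ is a finite sequence $A_1\dots A_m$ of (not necessarily distinct) points, $m\ge 1$, $A_1=X$, such that the segments $A_1A_2,\dots,A_{m-1}A_m,A_mA_1$ are contained in $N$. An elementary cancellation in $N$ is the removal of a vertex $B=A_i$, $i\ge 2$, such that the convex hull of $A,B,C$ is contained in $N$, where $A=A_{i-1}$ and $C=A_{i+1}$ ($A_{m+1}:=A_1$; possibly $A=C$). Two such lines are based homotopic if they can be joined by a finite sequence of such lines in which, of any two consecutive ones, one is obtained from the other by an elementary cancellation in $N$. The product of $XM_1\dots M_m$ and $XN_1\dots N_n$ is $XM_1\dots M_mXN_1\dots N_n$; it makes the set of based homotopy classes a group, whose identity element is the class of the one-point line $X$ and in which the inverse of the class of $A_1A_2\dots A_m$ is the class of $A_1A_m\dots A_2$. If the two rays do not pass through the vertices of a line $x$ (general position), then the Poincaré word of $x$ is the word obtained by moving along $x$ from $X$ back to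 $X$ and writing $a^{s}$ at every intersection with the ray $PP'$ and $b^{s}$ at every intersection with the ray $QQ'$. Here, for an intersection of the segment $AB$ of $x$ (traversed from $A$ to $B$) with the ray whose origin is $O\in\{P,Q\}$, the sign is $s=+1$ if the triangle $ABO$ is oriented clockwise, and $s=-1$ otherwise. Let $F_2=\langle a,b\rangle$ be the group of equivalence classes of words in $a,b,a^{-1},b^{-1}$ up to insertion and deletion of the subwords $aa^{-1},a^{-1}a,bb^{-1},b^{-1}b$, i.e. the free group on $a,b$. Then every based closed polygonal line in $N$ with basepoint $X$ is based homotopic to one in general position with respect to the rays, and there is a unique group isomorphism from the group of based homotopy classes to $F_2$ which, for every based closed polygonal line $x$ in general position with respect to the rays, sends the class of $x$ to the class of the Poincaré word of $x$. -/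

import Mathlib

namespace PlaneLoops

/-- The Euclidean plane. -/
abbrev Plane : Type := EuclideanSpace ℝ (Fin 2)

/-- A based closed polygonal line `A₁ A₂ … Aₘ` (with `m ≥ 1`) contained in `N ⊆ Plane`, with
basepoint `A₁ = X`. It is given by the list `tail = [A₂, …, Aₘ]` of its other vertices (points may
repeat); all the segments `A₁A₂, …, Aₘ₋₁Aₘ, AₘA₁` have to be contained in `N`. -/
@[ext]
structure BasedLine (N : Set Plane) (X : N) where
  tail : List Plane
  segment_subset : List.IsChain (fun A B => segment ℝ A B ⊆ N) ((X : Plane) :: (tail ++ [(X : Plane)]))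

namespace BasedLine

variable {N : Set Plane} {X : N}

/-- The sequence `A₁, A₂, …, Aₘ, A₁` of points visited when moving along the line. -/
def path (l : BasedLine N X) : List Plane := (X : Plane) :: (l.tail ++ [(X : Plane)])

/-- The vertices `A₁, …, Aₘ`. -/
def vertices (l : BasedLine N X) : List Plane := (X : Plane) :: l.tail

/-- `l'` is obtained from `l` by an elementary cancellation in `N` preserving the basepoint: a
vertex `B`, other than the first one, with neighbours `A` and `C` (possibly `A = C`), such that the
convex hull of `A, B, C` is contained in `N`, is removed. -/
def Cancels (l l' : BasedLine N X) : Prop :=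
  ∃ (L R : List Plane) (A B C : Plane), l.path = L ++ A :: B :: C :: R ∧
    l'.path = L ++ A :: C :: R ∧ convexHull ℝ {A, B, C} ⊆ N

/-- Based homotopy in `N`: the lines are joined by a finite sequence of based lines (with the same
basepoint) in which, of any two consecutive ones, one is obtained from the other by an elementary
cancellation. -/
def Homotopic (l l' : BasedLine N X) : Prop := Relation.EqvGen Cancels l l'

/-- Based homotopy as an equivalence relation. -/
def homotopySetoid (N : Set Plane) (X : N) : Setoid (BasedLine N X) where
  r := Homotopic
  iseqv := Relation.EqvGen.is_equivalence _

/-- The one-point line. -/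
def point (N : Set Plane) (X : N) : BasedLine N X where
  tail := []
  segment_subset := by simp

/-- The product `X M₁ … Mₘ X N₁ … Nₙ` of `X M₁ … Mₘ` and `X N₁ … Nₙ`. -/
def mul (l₁ l₂ : BasedLine N X) : BasedLine N X where
  tail := l₁.tail ++ (X : Plane) :: l₂.tail
  segment_subset := by
    have h := List.isChain_split (l₁ := (X : Plane) :: l₁.tail).2 ⟨l₁.segment_subset, l₂.segment_subset⟩
    simpa using h

theorem isChain_reverse {l : List Plane} (h : l.IsChain (fun A B => segment ℝ A B ⊆ N)) :
    l.reverse.IsChain (fun A B => segment ℝ A B ⊆ N) := by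
  rw [List.isChain_reverse]
  refine h.imp ?_
  intro A B hAB
  rwa [segment_symm]

/-- The inverse `A₁ Aₘ … A₂` of `A₁ A₂ … Aₘ`. -/
def inv (l : BasedLine N X) : BasedLine N X where
  tail := l.tail.reverse
  segment_subset := by simpa using isChain_reverse l.segment_subset

theorem Homotopic.map {f : BasedLine N X → BasedLine N X}
    (hf : ∀ l l', Cancels l l' → Homotopic (f l) (f l')) {l l' : BasedLine N X}
    (h : Homotopic l l') : Homotopic (f l) (f l') := by
  induction h with
  | rel _ _ h => exact hf _ _ h
  | refl _ => exact .refl _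
  | symm _ _ _ ih => exact .symm _ _ ih
  | trans _ _ _ _ _ ih₁ ih₂ => exact .trans _ _ _ ih₁ ih₂

theorem mul_homotopic {l₁ l₁' l₂ l₂' : BasedLine N X} (h₁ : Homotopic l₁ l₁')
    (h₂ : Homotopic l₂ l₂') : Homotopic (mul l₁ l₂) (mul l₁' l₂') := by
  refine Relation.EqvGen.trans _ (mul l₁' l₂) _ ?_ ?_
  · refine Homotopic.map (f := fun l => mul l l₂) ?_ h₁
    rintro l l' ⟨L, R, A, B, C, e, e', h⟩
    refine Relation.EqvGen.rel _ _ ⟨L, R ++ (l₂.tail ++ [(X : Plane)]), A, B, C, ?_, ?_, h⟩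
    · have : (mul l l₂).path = l.path ++ (l₂.tail ++ [(X : Plane)]) := by simp [path, mul]
      simp [this, e]
    · have : (mul l' l₂).path = l'.path ++ (l₂.tail ++ [(X : Plane)]) := by simp [path, mul]
      simp [this, e']
  · refine Homotopic.map (f := fun l => mul l₁' l) ?_ h₂
    rintro l l' ⟨L, R, A, B, C, e, e', h⟩
    refine Relation.EqvGen.rel _ _ ⟨(X : Plane) :: l₁'.tail ++ L, R, A, B, C, ?_, ?_, h⟩
    · have : (mul l₁' l).path = (X : Plane) :: l₁'.tail ++ l.path := by simp [path, mul]
      simp [this, e]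
    · have : (mul l₁' l').path = (X : Plane) :: l₁'.tail ++ l'.path := by simp [path, mul]
      simp [this, e']

theorem inv_homotopic {l l' : BasedLine N X} (h : Homotopic l l') :
    Homotopic (inv l) (inv l') := by
  refine Homotopic.map (f := inv) ?_ h
  rintro l l' ⟨L, R, A, B, C, e, e', h⟩
  have key : ∀ l : BasedLine N X, (inv l).path = l.path.reverse := by simp [path, inv]
  refine Relation.EqvGen.rel _ _ ⟨R.reverse, L.reverse, C, B, A, ?_, ?_, ?_⟩
  · simp [key, e]
  · simp [key, e']
  · have : ({C, B, A} : Set Plane) = {A, B, C} := by ext; simp; tauto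
    rwa [this]

theorem mul_assoc' (l₁ l₂ l₃ : BasedLine N X) :
    mul (mul l₁ l₂) l₃ = mul l₁ (mul l₂ l₃) := by
  ext1; simp [mul]

theorem point_mul_homotopic (l : BasedLine N X) : Homotopic (mul (point N X) l) l := by
  obtain ⟨C, R, hC⟩ : ∃ C R, l.tail ++ [(X : Plane)] = C :: R :=
    List.exists_cons_of_ne_nil (by simp)
  refine Relation.EqvGen.rel _ _ ⟨[], R, X, X, C, by simp [path, mul, point, hC], by simp [path, hC], ?_⟩
  have h := l.segment_subset
  rw [hC, List.isChain_cons_cons] at h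
  simpa [convexHull_pair] using h.1

theorem retrace_homotopic (t : List Plane) : ∀ (Y : Plane)
    (_ : List.IsChain (fun A B => segment ℝ A B ⊆ N) (Y :: (t ++ [(X : Plane)])))
    (l : BasedLine N X), l.tail = t.reverse ++ Y :: t → Homotopic l (point N X) := by
  induction t with
  | nil =>
    intro Y h l hl
    refine Relation.EqvGen.rel _ _ ⟨[], [], X, Y, X, by simp [path, hl], by simp [path, point], ?_⟩
    have h' : segment ℝ Y (X : Plane) ⊆ N := by simpa using h
    have : ({(X : Plane), Y, (X : Plane)} : Set Plane) = {Y, (X : Plane)} := by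
      ext; simp
    rwa [this, convexHull_pair]
  | cons M t ih =>
    intro Y h l hl
    rw [List.cons_append, List.isChain_cons_cons] at h
    have hc : List.IsChain (fun A B => segment ℝ A B ⊆ N)
        ((X : Plane) :: (t.reverse ++ M :: t ++ [(X : Plane)])) := by
      have h1 := isChain_reverse h.2
      have h2 := List.isChain_split (l₁ := (X : Plane) :: t.reverse).2 ⟨by simpa using h1, h.2⟩
      simpa using h2
    have hM : M ∈ N := h.1 (right_mem_segment ℝ Y M)
    have hc' : List.IsChain (fun A B => segment ℝ A B ⊆ N)
        ((X : Plane) :: (t.reverse ++ M :: M :: t ++ [(X : Plane)])) := by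
      have h1 := isChain_reverse h.2
      have h3 : List.IsChain (fun A B => segment ℝ A B ⊆ N) (M :: M :: (t ++ [(X : Plane)])) := by
        rw [List.isChain_cons_cons]
        exact ⟨by simpa using hM, h.2⟩
      have h2 := List.isChain_split (l₁ := (X : Plane) :: t.reverse).2 ⟨by simpa using h1, h3⟩
      simpa using h2
    refine Relation.EqvGen.trans _ ⟨t.reverse ++ M :: M :: t, hc'⟩ _ ?_
      (Relation.EqvGen.trans _ ⟨t.reverse ++ M :: t, hc⟩ _ ?_ (ih M h.2 _ rfl))
    · refine Relation.EqvGen.rel _ _ ⟨(X : Plane) :: t.reverse, t ++ [(X : Plane)], M, Y, M, by simp [path, hl],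
        by simp [path], ?_⟩
      have : ({M, Y, M} : Set Plane) = {Y, M} := by ext; simp
      rw [this, convexHull_pair]
      exact h.1
    · obtain ⟨C, R, hC⟩ : ∃ C R, t ++ [(X : Plane)] = C :: R :=
        List.exists_cons_of_ne_nil (by simp)
      refine Relation.EqvGen.rel _ _ ⟨(X : Plane) :: t.reverse, R, M, M, C, by simp [path, hC],
        by simp [path, hC], ?_⟩
      have h2 := h.2
      rw [hC, List.isChain_cons_cons] at h2
      simpa [convexHull_pair] using h2.1

theorem inv_mul_homotopic (l : BasedLine N X) : Homotopic (mul (inv l) l) (point N X) :=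
  retrace_homotopic l.tail X l.segment_subset _ rfl

end BasedLine

/-- The set of based homotopy classes, in `N`, of based closed polygonal lines with basepoint `X`. -/
def LoopClass (N : Set Plane) (X : N) : Type := Quotient (BasedLine.homotopySetoid N X)

namespace LoopClass

variable {N : Set Plane} {X : N}

/-- The based homotopy class of a based closed polygonal line. -/
def mk (l : BasedLine N X) : LoopClass N X := Quotient.mk (BasedLine.homotopySetoid N X) l

theorem mk_eq {l l' : BasedLine N X} (h : BasedLine.Homotopic l l') : mk l = mk l' :=
  Quotient.sound (s := BasedLine.homotopySetoid N X) h

/-- Product of classes: the class of the concatenation. -/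
instance : Mul (LoopClass N X) where
  mul := Quotient.map₂ BasedLine.mul fun _ _ h₁ _ _ h₂ => BasedLine.mul_homotopic h₁ h₂

instance : One (LoopClass N X) where
  one := mk (BasedLine.point N X)

instance : Inv (LoopClass N X) where
  inv := Quotient.map BasedLine.inv fun _ _ h => BasedLine.inv_homotopic h

theorem mk_mul (l₁ l₂ : BasedLine N X) : mk l₁ * mk l₂ = mk (BasedLine.mul l₁ l₂) := rfl

theorem mk_inv (l : BasedLine N X) : (mk l)⁻¹ = mk (BasedLine.inv l) := rfl

theorem one_eq : (1 : LoopClass N X) = mk (BasedLine.point N X) := rfl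

/-- The group of based homotopy classes. -/
instance : Group (LoopClass N X) :=
  Group.ofLeftAxioms
    (by
      rintro ⟨a⟩ ⟨b⟩ ⟨c⟩
      exact congrArg mk (BasedLine.mul_assoc' a b c))
    (by
      rintro ⟨a⟩
      exact mk_eq (BasedLine.point_mul_homotopic a))
    (by
      rintro ⟨a⟩
      exact mk_eq (BasedLine.inv_mul_homotopic a))

end LoopClass

/-- The closed ray with origin `P` passing through `P'` (meant for `P' ≠ P`). -/
def ray (P P' : Plane) : Set Plane := {Z | ∃ t : ℝ, 0 ≤ t ∧ Z = P + t • (P' - P)}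

/-- Twice the signed area of the triangle `ABC`: positive if `ABC` is oriented counterclockwise,
negative if it is oriented clockwise. -/
def signedArea (A B C : Plane) : ℝ :=
  (B 0 - A 0) * (C 1 - A 1) - (B 1 - A 1) * (C 0 - A 0)

open Classical in
/-- The contribution of the ray `PP'`, marked by the letter `g`, to the word of the oriented segment
`AB`: empty if they do not meet, and otherwise the one-letter word `g ^ s`, where `s` is the sign of
the intersection point, `+1` (encoded by `true`) if `ABP` is oriented clockwise and `-1` (encoded by
`false`) if not. Used only when neither `A` nor `B` is on the ray and `P` is not on the segment, so
that there is at most one intersection point and it is a proper crossing. -/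
noncomputable def crossing (g : Fin 2) (P P' A B : Plane) : List (Fin 2 × Bool) :=
  if (segment ℝ A B ∩ ray P P').Nonempty then [(g, decide (signedArea A B P < 0))] else []

open Classical in
/-- The word written out when moving from `A` to `B` along a segment: the letter `a`, encoded by `0`
(the letter `b`, encoded by `1`), with the sign as an exponent, at an intersection with the ray `PP'`
(with the ray `QQ'`), in the order of the intersection points on the way from `A` to `B`. -/
noncomputable def segmentWord (P P' Q Q' A B : Plane) : List (Fin 2 × Bool) :=
  if ∃ U ∈ segment ℝ A B ∩ ray P P', ∃ V ∈ segment ℝ A B ∩ ray Q Q', U ∈ segment ℝ A V then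
    crossing 0 P P' A B ++ crossing 1 Q Q' A B
  else
    crossing 1 Q Q' A B ++ crossing 0 P P' A B

/-- The word written out when moving along the successive points of a list. -/
noncomputable def pathWord (P P' Q Q' : Plane) : List Plane → List (Fin 2 × Bool)
  | [] => []
  | [_] => []
  | A :: B :: L => segmentWord P P' Q Q' A B ++ pathWord P P' Q Q' (B :: L)

namespace BasedLine

variable {N : Set Plane} {X : N}

/-- The Poincaré word of a based closed polygonal line, moving from the basepoint to itself. -/
noncomputable def poincareWord (P P' Q Q' : Plane) (l : BasedLine N X) : List (Fin 2 × Bool) :=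
  pathWord P P' Q Q' l.path

/-- The rays `PP'` and `QQ'` are in general position with respect to `l`: they do not pass through
the vertices of `l`. -/
def GeneralPosition (P P' Q Q' : Plane) (l : BasedLine N X) : Prop :=
  ∀ V ∈ l.vertices, V ∉ ray P P' ∧ V ∉ ray Q Q'

end BasedLine

end PlaneLoops

namespace PlaneLoops

/-! ### Convexity and signed areas -/

/-! The Poincaré word is read off edge by edge. Its class extends to a function `segVal` on all
ordered pairs of points with values in the free group. This function is a cocycle: its values on
`AB` and `BC` multiply to its value on `AC` whenever the triangle `ABC` avoids `P` and `Q`. The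
product along the edges is therefore a homotopy invariant, the homomorphism `valueHom`.

The exponents are signed crossing numbers. By the convention that points of the line `PP'` lie to
its left, `crossNumber` is defined for arbitrary end points and is additive on triangles avoiding
`P` (`crossNumber_add`). The order of the two letters is governed by a linear functional `f` that
separates the rays (`exists_separates`). These facts give `Separates.segVal_mul`, and
`Separates.mk_segmentWord` identifies `segVal` with the word in general position.

Injectivity comes from the universality of `segVal`. By `exists_hom_of_cocycle`, every cocycle on
the twice punctured plane, with values in any group, is the image of `segVal` under a homomorphism,
up to a coboundary. This is a van Kampen argument: it is proved for one puncture in a convex set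
(`CocycleOn.eq_potential`) and glued along the line `f = s`. Applied to the tautological cocycle
with values in the group of loop classes (`PathChoice.cocycle`), whose product along a loop is the
class of that loop, it yields a left inverse of `valueHom`.

Explicit loops off the rays realize every value (`Separates.exists_routes`). This gives surjectivity
and, together with injectivity, a representative in general position of every class, without any
perturbation of lines. -/

theorem mem_convexHull_triple {A B C Z : Plane} :
    Z ∈ convexHull ℝ ({A, B, C} : Set Plane) ↔
      ∃ a b c : ℝ, 0 ≤ a ∧ 0 ≤ b ∧ 0 ≤ c ∧ a + b + c = 1 ∧ a • A + b • B + c • C = Z := by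
  rw [convexHull_insert (by simp), convexHull_pair, mem_convexJoin]
  constructor
  · rintro ⟨_, rfl, Y, ⟨b, c, hb, hc, hbc, rfl⟩, ⟨x, y, hx, hy, hxy, rfl⟩⟩
    refine ⟨x, y * b, y * c, hx, by positivity, by positivity, ?_, ?_⟩
    · rw [add_assoc, ← mul_add, hbc, mul_one, hxy]
    · simp [smul_smul, add_assoc]
  · rintro ⟨a, b, c, ha, hb, hc, h, rfl⟩
    rcases eq_or_ne (b + c) 0 with h0 | h0
    · have hb0 : b = 0 := by linarith
      have hc0 : c = 0 := by linarith
      have ha1 : a = 1 := by linarith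
      exact ⟨A, rfl, B, left_mem_segment ℝ _ _, by simpa [hb0, hc0, ha1] using left_mem_segment ℝ A B⟩
    · refine ⟨A, rfl, (b / (b + c)) • B + (c / (b + c)) • C,
        ⟨_, _, by positivity, by positivity, by field_simp, rfl⟩,
        ⟨a, b + c, ha, by positivity, by linarith, ?_⟩⟩
      rw [smul_add, smul_smul, smul_smul, mul_div_cancel₀ _ h0, mul_div_cancel₀ _ h0, add_assoc]

theorem plane_ext {A B : Plane} (h0 : A 0 = B 0) (h1 : A 1 = B 1) : A = B := by
  ext i; fin_cases i <;> assumption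

theorem segment_subset_convexHull_left {A B C : Plane} :
    segment ℝ A B ⊆ convexHull ℝ ({A, B, C} : Set Plane) :=
  segment_subset_convexHull (by simp) (by simp)

theorem segment_subset_convexHull_right {A B C : Plane} :
    segment ℝ B C ⊆ convexHull ℝ ({A, B, C} : Set Plane) :=
  segment_subset_convexHull (by simp) (by simp)

theorem segment_subset_convexHull_outer {A B C : Plane} :
    segment ℝ A C ⊆ convexHull ℝ ({A, B, C} : Set Plane) :=
  segment_subset_convexHull (by simp) (by simp)

/-- The three signed areas are proportional to the barycentric coordinates of `P`; one strict
inequality keeps their sum from vanishing. -/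
theorem mem_convexHull_of_signedArea {A B C P : Plane} (h1 : 0 ≤ signedArea B C P)
    (h2 : 0 < signedArea C A P) (h3 : 0 ≤ signedArea A B P) :
    P ∈ convexHull ℝ ({A, B, C} : Set Plane) := by
  set x := signedArea B C P with hx
  set y := signedArea C A P with hy
  set z := signedArea A B P with hz
  have hs : 0 < x + y + z := by linarith
  rw [mem_convexHull_triple]
  refine ⟨x / (x + y + z), y / (x + y + z), z / (x + y + z), by positivity, by positivity,
    by positivity, by field_simp, ?_⟩
  apply plane_ext <;> simp only [PiLp.add_apply, PiLp.smul_apply, smul_eq_mul] <;> field_simp <;>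
    simp only [hx, hy, hz, signedArea] <;> ring

theorem signedArea_swap (A B P : Plane) : signedArea B A P = -signedArea A B P := by
  simp only [signedArea]; ring

/-- The barycentric identity, seen from the line `PP'`. -/
theorem signedArea_mul_add (P P' A B C : Plane) :
    signedArea B C P * signedArea P P' A + signedArea C A P * signedArea P P' B +
      signedArea A B P * signedArea P P' C = 0 := by
  simp only [signedArea]; ring

theorem signedArea_combo₃ (P P' A B C : Plane) {a b c : ℝ} (h : a + b + c = 1) :
    signedArea P P' (a • A + b • B + c • C) =
      a * signedArea P P' A + b * signedArea P P' B + c * signedArea P P' C := by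
  obtain rfl : a = 1 - b - c := by linarith
  simp only [signedArea, PiLp.add_apply, PiLp.smul_apply, smul_eq_mul]; ring

@[simp] theorem signedArea_origin (P P' : Plane) : signedArea P P' P = 0 := by
  simp [signedArea]

theorem signedArea_ray (P P' : Plane) (t : ℝ) : signedArea P P' (P + t • (P' - P)) = 0 := by
  simp only [signedArea, PiLp.add_apply, PiLp.smul_apply, PiLp.sub_apply, smul_eq_mul]; ring

theorem exists_of_signedArea_eq_zero {P P' A : Plane} (hP : P' ≠ P)
    (h : signedArea P P' A = 0) : ∃ t : ℝ, A = P + t • (P' - P) := by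
  have hd : 0 < (P' 0 - P 0) ^ 2 + (P' 1 - P 1) ^ 2 := by
    by_contra hc
    have h0 : P' 0 - P 0 = 0 := by nlinarith [sq_nonneg (P' 0 - P 0), sq_nonneg (P' 1 - P 1)]
    have h1 : P' 1 - P 1 = 0 := by nlinarith [sq_nonneg (P' 0 - P 0), sq_nonneg (P' 1 - P 1)]
    exact hP (plane_ext (by linarith) (by linarith))
  -- The parameter of the orthogonal projection of `A` to the line `PP'`.
  refine ⟨((P' 0 - P 0) * (A 0 - P 0) + (P' 1 - P 1) * (A 1 - P 1)) /
    ((P' 0 - P 0) ^ 2 + (P' 1 - P 1) ^ 2), ?_⟩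
  simp only [signedArea] at h
  apply plane_ext <;>
    simp only [PiLp.add_apply, PiLp.smul_apply, PiLp.sub_apply, smul_eq_mul] <;> field_simp
  · linear_combination (-(P' 1 - P 1)) * h
  · linear_combination ((P' 0 - P 0)) * h

theorem origin_mem_ray (P P' : Plane) : P ∈ ray P P' := ⟨0, le_rfl, by simp⟩

/-- If the side values of `A` and `B` differ, the line `PP'` meets the line `AB` in this point. -/
theorem line_point_eq {P P' A B : Plane} (h : signedArea P P' B - signedArea P P' A ≠ 0) :
    (signedArea P P' B / (signedArea P P' B - signedArea P P' A)) • A +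
      (-signedArea P P' A / (signedArea P P' B - signedArea P P' A)) • B =
      P + (signedArea A B P / (signedArea P P' B - signedArea P P' A)) • (P' - P) := by
  set D := signedArea P P' B - signedArea P P' A with hD
  apply plane_ext <;>
    simp only [PiLp.add_apply, PiLp.smul_apply, PiLp.sub_apply, smul_eq_mul] <;> field_simp <;>
    simp only [hD, signedArea] <;> ring

theorem mem_segment_of_signedArea_neg {P P' A B : Plane} (hA : signedArea P P' A < 0)
    (hB : 0 ≤ signedArea P P' B) :
    P + (signedArea A B P / (signedArea P P' B - signedArea P P' A)) • (P' - P) ∈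
      segment ℝ A B := by
  have hD : 0 < signedArea P P' B - signedArea P P' A := by linarith
  rw [← line_point_eq hD.ne']
  refine ⟨_, _, by positivity, div_nonneg (by linarith) hD.le, ?_, rfl⟩
  field_simp; ring

theorem signedArea_eq_zero_of_mem_segment {P A B : Plane} (h : P ∈ segment ℝ A B) :
    signedArea A B P = 0 := by
  obtain ⟨a, b, ha, hb, hab, rfl⟩ := h
  obtain rfl : a = 1 - b := by linarith
  simp only [signedArea, PiLp.add_apply, PiLp.smul_apply, smul_eq_mul]; ring

/-- The affine function `signedArea P P'` vanishes at `P`, is nonnegative at `A` and `B` and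
positive at `Y`. A convex combination equal to `P` thus gives `Y` the weight 0. -/
theorem not_mem_convexHull_of_pos {P P' A B Y : Plane} (hY : 0 < signedArea P P' Y)
    (hA : 0 ≤ signedArea P P' A) (hB : 0 ≤ signedArea P P' B) (h : P ∉ segment ℝ A B) :
    P ∉ convexHull ℝ ({A, B, Y} : Set Plane) := by
  rw [mem_convexHull_triple]
  rintro ⟨a, b, c, ha, hb, hc, habc, e⟩
  have h1 := signedArea_combo₃ P P' A B Y habc
  rw [e, signedArea_origin] at h1
  have h2 : c * signedArea P P' Y = 0 := by
    have := mul_nonneg ha hA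
    have := mul_nonneg hb hB
    have := mul_nonneg hc hY.le
    linarith
  have hc0 : c = 0 := by simpa [hY.ne'] using h2
  exact h ⟨a, b, ha, hb, by linarith, by simpa [hc0] using e⟩

theorem not_mem_segment_of_pos {P P' A Y : Plane} (hY : 0 < signedArea P P' Y)
    (hA : 0 ≤ signedArea P P' A) (h : A ≠ P) : P ∉ segment ℝ A Y := by
  have := not_mem_convexHull_of_pos hY hA hA (B := A) (by simpa using h.symm)
  simpa [convexHull_pair] using this

/-- Reflecting `P'` in `P` exchanges the two sides. -/
theorem signedArea_reflect (P P' A : Plane) :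
    signedArea P (P - (P' - P)) A = -signedArea P P' A := by
  simp only [signedArea, PiLp.sub_apply]; ring

theorem not_mem_convexHull_of_neg {P P' A B Y : Plane} (hY : signedArea P P' Y < 0)
    (hA : signedArea P P' A ≤ 0) (hB : signedArea P P' B ≤ 0) (h : P ∉ segment ℝ A B) :
    P ∉ convexHull ℝ ({A, B, Y} : Set Plane) := by
  refine not_mem_convexHull_of_pos (P' := P - (P' - P)) ?_ ?_ ?_ h <;>
    rw [signedArea_reflect] <;> linarith

theorem not_mem_segment_of_neg {P P' A Y : Plane} (hY : signedArea P P' Y < 0)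
    (hA : signedArea P P' A ≤ 0) (h : A ≠ P) : P ∉ segment ℝ A Y := by
  refine not_mem_segment_of_pos (P' := P - (P' - P)) ?_ ?_ h <;>
    rw [signedArea_reflect] <;> linarith

/-- A triangle with one vertex on the opposite ray contains `P` only if its opposite side meets
the ray `PP'`. -/
theorem not_mem_convexHull_of_disjoint_ray {P P' A B : Plane} {r : ℝ} (hP : P' ≠ P) (hr : 0 < r)
    (h : ∀ V ∈ segment ℝ A B, V ∉ ray P P') :
    P ∉ convexHull ℝ ({P - r • (P' - P), A, B} : Set Plane) := by
  rw [mem_convexHull_triple]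
  rintro ⟨a, b, c, ha, hb, hc, habc, e⟩
  have hbc : b + c ≠ 0 := by
    intro h0
    obtain rfl : b = 0 := by linarith
    obtain rfl : c = 0 := by linarith
    obtain rfl : a = 1 := by linarith
    have : r • (P' - P) = 0 := by simpa using e
    rcases smul_eq_zero.1 this with h | h
    · exact hr.ne' h
    · exact hP (sub_eq_zero.1 h)
  have hbc' : 0 < b + c := by positivity
  -- Solving `e` for `b • A + c • B` and dividing by `b + c = 1 - a` gives a point of the ray, with
  -- parameter `a * r / (b + c)`.
  refine h ((b / (b + c)) • A + (c / (b + c)) • B)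
    ⟨_, _, by positivity, by positivity, by field_simp, rfl⟩ ⟨a * r / (b + c), by positivity, ?_⟩
  obtain rfl : a = 1 - b - c := by linarith
  have e0 := congrArg (fun Z : Plane => Z 0) e
  have e1 := congrArg (fun Z : Plane => Z 1) e
  simp only [PiLp.add_apply, PiLp.smul_apply, PiLp.sub_apply, smul_eq_mul] at e0 e1
  apply plane_ext <;>
    simp only [PiLp.add_apply, PiLp.smul_apply, PiLp.sub_apply, smul_eq_mul] <;> field_simp <;>
    linarith

/-! ### Crossing numbers -/

open Classical in
/-- The signed number of crossings of the segment `AB` with the ray `PP'`, points on the line `PP'`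
being considered as lying to its left. -/
noncomputable def crossNumber (P P' A B : Plane) : ℤ :=
  if signedArea P P' A < 0 ∧ 0 ≤ signedArea P P' B ∧ 0 < signedArea A B P then -1
  else if signedArea P P' B < 0 ∧ 0 ≤ signedArea P P' A ∧ signedArea A B P < 0 then 1
  else 0

theorem crossNumber_swap (P P' A B : Plane) : crossNumber P P' B A = -crossNumber P P' A B := by
  unfold crossNumber
  rw [signedArea_swap A B]
  split_ifs <;> first | rfl | (exfalso; grind)

theorem crossNumber_eq_zero {P P' A B : Plane} (hA : 0 ≤ signedArea P P' A)
    (hB : 0 ≤ signedArea P P' B) : crossNumber P P' A B = 0 := by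
  simp [crossNumber, hA.not_gt, hB.not_gt]

theorem crossNumber_eq_zero_of_neg {P P' A B : Plane} (hA : signedArea P P' A < 0)
    (hB : signedArea P P' B < 0) : crossNumber P P' A B = 0 := by
  simp [crossNumber, hA.not_ge, hB.not_ge]

theorem crossNumber_of_neg_of_nonneg {P P' A B : Plane} (hA : signedArea P P' A < 0)
    (hB : 0 ≤ signedArea P P' B) :
    crossNumber P P' A B = if 0 < signedArea A B P then -1 else 0 := by
  simp [crossNumber, hA, hB, hB.not_gt]

theorem crossNumber_of_nonneg_of_neg {P P' A B : Plane} (hA : 0 ≤ signedArea P P' A)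
    (hB : signedArea P P' B < 0) :
    crossNumber P P' A B = if signedArea A B P < 0 then 1 else 0 := by
  simp [crossNumber, hA, hB, hA.not_gt]

theorem exists_mem_segment_ray_of_crossNumber_ne_zero {P P' A B : Plane}
    (h : crossNumber P P' A B ≠ 0) : (segment ℝ A B ∩ ray P P').Nonempty := by
  unfold crossNumber at h
  split_ifs at h with h1 h2
  · exact ⟨_, mem_segment_of_signedArea_neg h1.1 h1.2.1, _,
      div_nonneg h1.2.2.le (by linarith [h1.1, h1.2.1]), rfl⟩
  · refine ⟨_, segment_symm ℝ B A ▸ mem_segment_of_signedArea_neg h2.1 h2.2.1, _,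
      div_nonneg ?_ (by linarith [h2.1, h2.2.1]), rfl⟩
    rw [signedArea_swap]; linarith [h2.2.2]
  · exact absurd rfl h

/-- The segment `AB` meets the line `PP'` beyond `P` on the ray. If `AC` met it at `P` or behind
`P`, then `P` would lie in the triangle. The sign of the third area comes from `signedArea_mul_add`.
-/
theorem signedArea_pos_iff_of_neg {P P' A B C : Plane} (hA : signedArea P P' A < 0)
    (hB : 0 ≤ signedArea P P' B) (hC : 0 ≤ signedArea P P' C)
    (h : P ∉ convexHull ℝ ({A, B, C} : Set Plane)) (hAB : 0 < signedArea A B P) :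
    0 < signedArea A C P := by
  by_contra hAC
  rcases (not_lt.1 hAC).eq_or_lt with h0 | h0
  · have := mem_segment_of_signedArea_neg hA hC
    rw [h0] at this
    exact h (segment_subset_convexHull_outer (by simpa using this))
  · refine h (mem_convexHull_of_signedArea ?_ ?_ hAB.le)
    · have e := signedArea_mul_add P P' A B C
      rw [signedArea_swap A C] at e
      by_contra hn
      have := mul_pos_of_neg_of_neg (not_le.1 hn) hA
      have := mul_nonneg (neg_nonneg.2 h0.le) hB
      have := mul_nonneg hAB.le hC
      linarith
    · rw [signedArea_swap]; linarith

theorem signedArea_neg_iff_of_nonneg {P P' A B C : Plane} (hA : 0 ≤ signedArea P P' A)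
    (hB : signedArea P P' B < 0) (hC : signedArea P P' C < 0)
    (h : P ∉ convexHull ℝ ({A, B, C} : Set Plane)) (hAB : signedArea A B P < 0) :
    signedArea A C P < 0 := by
  by_contra hAC
  rcases (not_lt.1 hAC).eq_or_lt with h0 | h0
  · have := mem_segment_of_signedArea_neg hC hA
    rw [signedArea_swap, ← h0, segment_symm] at this
    exact h (segment_subset_convexHull_outer (by simpa using this))
  · have e : ({A, B, C} : Set Plane) = {A, C, B} := by ext; simp; tauto
    rw [e] at h
    refine h (mem_convexHull_of_signedArea ?_ ?_ h0.le)
    · have e := signedArea_mul_add P P' A C B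
      rw [signedArea_swap A B] at e
      by_contra hn
      have := mul_nonneg_of_nonpos_of_nonpos (not_le.1 hn).le (neg_nonpos.2 hA)
      have := mul_neg_of_pos_of_neg (neg_pos.2 hAB) hC
      have := mul_neg_of_pos_of_neg h0 hB
      nlinarith
    · rw [signedArea_swap]; linarith

/-- The crossing number is additive on triangles that do not contain the origin of the ray. -/
theorem crossNumber_add {P P' A B C : Plane} (h : P ∉ convexHull ℝ ({A, B, C} : Set Plane)) :
    crossNumber P P' A B + crossNumber P P' B C = crossNumber P P' A C := by
  have perm : ∀ {A B C A' B' C' : Plane}, P ∉ convexHull ℝ ({A, B, C} : Set Plane) →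
      ({A, B, C} : Set Plane) = {A', B', C'} → P ∉ convexHull ℝ ({A', B', C'} : Set Plane) := by
    intro A B C A' B' C' h e; rwa [← e]
  -- If a vertex is alone on its side of the line `PP'`, its two edges have equal crossing numbers,
  -- and the opposite edge has crossing number 0. `eq1` and `eq2` treat the two possible sides of
  -- that vertex.
  have eq1 : ∀ {A B C : Plane}, P ∉ convexHull ℝ ({A, B, C} : Set Plane) →
      signedArea P P' A < 0 → 0 ≤ signedArea P P' B → 0 ≤ signedArea P P' C →
      crossNumber P P' A B = crossNumber P P' A C := by
    intro A B C h hA hB hC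
    rw [crossNumber_of_neg_of_nonneg hA hB, crossNumber_of_neg_of_nonneg hA hC]
    have : 0 < signedArea A B P ↔ 0 < signedArea A C P :=
      ⟨signedArea_pos_iff_of_neg hA hB hC h, signedArea_pos_iff_of_neg hA hC hB
        (perm h (by ext; simp; tauto))⟩
    simp [this]
  have eq2 : ∀ {A B C : Plane}, P ∉ convexHull ℝ ({A, B, C} : Set Plane) →
      0 ≤ signedArea P P' A → signedArea P P' B < 0 → signedArea P P' C < 0 →
      crossNumber P P' A B = crossNumber P P' A C := by
    intro A B C h hA hB hC
    rw [crossNumber_of_nonneg_of_neg hA hB, crossNumber_of_nonneg_of_neg hA hC]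
    have : signedArea A B P < 0 ↔ signedArea A C P < 0 :=
      ⟨signedArea_neg_iff_of_nonneg hA hB hC h, signedArea_neg_iff_of_nonneg hA hC hB
        (perm h (by ext; simp; tauto))⟩
    simp [this]
  have hB' : P ∉ convexHull ℝ ({B, A, C} : Set Plane) := perm h (by ext; simp; tauto)
  have hC' : P ∉ convexHull ℝ ({C, A, B} : Set Plane) := perm h (by ext; simp; tauto)
  rcases lt_or_ge (signedArea P P' A) 0 with hA | hA <;>
  rcases lt_or_ge (signedArea P P' B) 0 with hB | hB <;>
  rcases lt_or_ge (signedArea P P' C) 0 with hC | hC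
  · simp [crossNumber_eq_zero_of_neg, hA, hB, hC]
  · have := eq2 hC' hC hA hB
    rw [crossNumber_eq_zero_of_neg hA hB, crossNumber_swap P P' C A, crossNumber_swap P P' C B, this,
      zero_add]
  · have := eq2 hB' hB hA hC
    rw [crossNumber_eq_zero_of_neg hA hC, crossNumber_swap P P' B A, this, neg_add_cancel]
  · rw [crossNumber_eq_zero hB hC, eq1 h hA hB hC, add_zero]
  · rw [crossNumber_eq_zero_of_neg hB hC, eq2 h hA hB hC, add_zero]
  · have := eq1 hB' hB hA hC
    rw [crossNumber_eq_zero hA hC, crossNumber_swap P P' B A, this, neg_add_cancel]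
  · have := eq1 hC' hC hA hB
    rw [crossNumber_eq_zero hA hB, crossNumber_swap P P' C A, crossNumber_swap P P' C B, this,
      zero_add]
  · simp [crossNumber_eq_zero, hA, hB, hC]

/-- The crossing number in general position. -/
theorem crossNumber_of_mem_ray {P P' A B W : Plane} (hP : P' ≠ P) (hA : A ∉ ray P P')
    (hB : B ∉ ray P P') (hAB : P ∉ segment ℝ A B) (hW : W ∈ segment ℝ A B) (hW' : W ∈ ray P P') :
    crossNumber P P' A B = if signedArea A B P < 0 then 1 else -1 := by
  obtain ⟨s, hs, rfl⟩ := hW'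
  have hs : 0 < s := by
    refine hs.lt_of_ne ?_
    rintro rfl
    exact hAB (by simpa using hW)
  have hW0 : P + s • (P' - P) ∈ ray P P' := ⟨s, hs.le, rfl⟩
  obtain ⟨a, b, ha, hb, hab, e⟩ := hW
  have ha0 : 0 < a := ha.lt_of_ne (by
    rintro rfl
    obtain rfl : b = 1 := by linarith
    exact hB (by rw [← e] at hW0; simpa using hW0))
  have hb0 : 0 < b := hb.lt_of_ne (by
    rintro rfl
    obtain rfl : a = 1 := by linarith
    exact hA (by rw [← e] at hW0; simpa using hW0))
  have e0 := congrArg (fun Z : Plane => Z 0) e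
  have e1 := congrArg (fun Z : Plane => Z 1) e
  simp only [PiLp.add_apply, PiLp.smul_apply, PiLp.sub_apply, smul_eq_mul] at e0 e1
  -- Since `a`, `b` and `s` are positive, `h1` and `h2` make the sign of `signedArea A B P`
  -- determine the sides of `A` and `B`.
  have h1 : b * signedArea A B P = -s * signedArea P P' A := by
    obtain rfl : a = 1 - b := by linarith
    simp only [signedArea]
    linear_combination (A 1 - P 1) * (-1) * e0 + (A 0 - P 0) * e1
  have h2 : a * signedArea A B P = s * signedArea P P' B := by
    obtain rfl : b = 1 - a := by linarith
    simp only [signedArea]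
    linear_combination (B 1 - P 1) * e0 - (B 0 - P 0) * e1
  rcases lt_trichotomy (signedArea A B P) 0 with h | h | h
  · have hA' : 0 < signedArea P P' A := by
      have := mul_neg_of_pos_of_neg hb0 h
      by_contra hn
      nlinarith
    have hB' : signedArea P P' B < 0 := by
      have := mul_neg_of_pos_of_neg ha0 h
      by_contra hn
      nlinarith
    rw [crossNumber_of_nonneg_of_neg hA'.le hB']
    simp [h]
  -- Here `A` and `B` are on the line `PP'` but off the ray, so both are strictly behind `P` and the
  -- segment cannot reach the ray.
  · exfalso
    rw [h, mul_zero] at h1 h2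
    have hA' : signedArea P P' A = 0 := by
      rcases mul_eq_zero.1 h1.symm with h | h
      · linarith
      · exact h
    have hB' : signedArea P P' B = 0 := by
      rcases mul_eq_zero.1 h2.symm with h | h
      · linarith
      · exact h
    obtain ⟨x, rfl⟩ := exists_of_signedArea_eq_zero hP hA'
    obtain ⟨y, rfl⟩ := exists_of_signedArea_eq_zero hP hB'
    have hx : x < 0 := by
      by_contra hx
      exact hA ⟨x, not_lt.1 hx, rfl⟩
    have hy : y < 0 := by
      by_contra hy
      exact hB ⟨y, not_lt.1 hy, rfl⟩
    have h3 : (a * x + b * y - s) • (P' - P) = 0 := by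
      obtain rfl : a = 1 - b := by linarith
      have := sub_eq_zero.2 e
      rw [← this]; module
    rcases smul_eq_zero.1 h3 with h | h
    · nlinarith
    · exact hP (sub_eq_zero.1 h)
  · have hA' : signedArea P P' A < 0 := by
      have := mul_pos hb0 h
      by_contra hn
      nlinarith
    have hB' : 0 < signedArea P P' B := by
      have := mul_pos ha0 h
      by_contra hn
      nlinarith
    rw [crossNumber_of_neg_of_nonneg hA' hB'.le]
    simp [h, h.le]

theorem mk_crossing (g : Fin 2) {P P' A B : Plane} (hP : P' ≠ P) (hA : A ∉ ray P P')
    (hB : B ∉ ray P P') (hAB : P ∉ segment ℝ A B) :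
    FreeGroup.mk (crossing g P P' A B) = FreeGroup.of g ^ crossNumber P P' A B := by
  unfold crossing
  split_ifs with h
  · obtain ⟨W, hW, hW'⟩ := h
    rw [crossNumber_of_mem_ray hP hA hB hAB hW hW']
    split_ifs with hs
    · simp [hs, FreeGroup.of]
    · simp [hs, FreeGroup.of, FreeGroup.inv_mk, FreeGroup.invRev]
  · have : crossNumber P P' A B = 0 := by
      by_contra hn
      exact h (exists_mem_segment_ray_of_crossNumber_ne_zero hn)
    rw [this, zpow_zero]; rfl

/-! ### Separating the rays -/

/-- The rays are on different sides of the line `f = s`. -/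
def Separates (f : Plane →ₗ[ℝ] ℝ) (s : ℝ) (P P' Q Q' : Plane) : Prop :=
  (∀ Z ∈ ray P P', f Z < s) ∧ ∀ Z ∈ ray Q Q', s < f Z

theorem separates_of_lt {f : Plane →ₗ[ℝ] ℝ} {P P' Q Q' : Plane} (h : f P < f Q)
    (hP : f (P' - P) ≤ 0) (hQ : 0 ≤ f (Q' - Q)) : Separates f ((f P + f Q) / 2) P P' Q Q' := by
  constructor <;> rintro _ ⟨t, ht, rfl⟩ <;> rw [map_add, map_smul, smul_eq_mul]
  · have := mul_nonneg ht (neg_nonneg.2 hP)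
    linarith
  · have := mul_nonneg ht hQ
    linarith

/-- It suffices that `f P < f Q` and that `f` does not increase along the first ray nor decrease
along the second. The functional is explicit in each relative position of the two lines; `D` is the
determinant of the directions. -/
theorem exists_separates {P P' Q Q' : Plane} (hP : P' ≠ P)
    (hdisj : Disjoint (ray P P') (ray Q Q')) :
    ∃ (f : Plane →ₗ[ℝ] ℝ) (s : ℝ), Separates f s P P' Q Q' := by
  suffices h : ∃ f : Plane →ₗ[ℝ] ℝ, f P < f Q ∧ f (P' - P) ≤ 0 ∧ 0 ≤ f (Q' - Q) by
    obtain ⟨f, h, h1, h2⟩ := h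
    exact ⟨f, _, separates_of_lt h h1 h2⟩
  have hd : ∀ t t' : ℝ, 0 ≤ t → 0 ≤ t' → P + t • (P' - P) ≠ Q + t' • (Q' - Q) := by
    intro t t' ht ht' h
    exact Set.disjoint_left.1 hdisj ⟨t, ht, rfl⟩ ⟨t', ht', h⟩
  have hlin : ∀ x y : ℝ, ∃ f : Plane →ₗ[ℝ] ℝ, ∀ Z, f Z = x * Z 0 + y * Z 1 := fun x y =>
    ⟨⟨⟨fun Z => x * Z 0 + y * Z 1, by intros; simp; ring⟩, by intros; simp; ring⟩, fun _ => rfl⟩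
  set D := (P' 0 - P 0) * (Q' 1 - Q 1) - (P' 1 - P 1) * (Q' 0 - Q 0) with hD
  rcases eq_or_ne D 0 with h0 | h0
  · -- parallel rays
    set u := signedArea P P' Q with hu
    rcases eq_or_ne u 0 with h1 | h1
    · obtain ⟨m, hm⟩ := exists_of_signedArea_eq_zero hP h1
      have hQ' : signedArea P P' Q' = 0 := by
        have : signedArea P P' Q' = u + D := by simp only [hu, hD, signedArea]; ring
        rw [this, h0, h1, add_zero]
      obtain ⟨m', hm'⟩ := exists_of_signedArea_eq_zero hP hQ'
      have hm0 : m < 0 := by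
        by_contra hn
        exact hd m 0 (not_lt.1 hn) le_rfl (by rw [zero_smul, add_zero, hm])
      -- Otherwise the ray `QQ'`, which starts behind `P`, runs towards `P` and contains it.
      have hmm : m' ≤ m := by
        by_contra hn
        have hpos : 0 < m' - m := by linarith
        refine hd 0 (-m / (m' - m)) le_rfl (div_nonneg (by linarith) hpos.le) ?_
        rw [hm, hm']
        have : P + m • (P' - P) + (-m / (m' - m)) • (P + m' • (P' - P) - (P + m • (P' - P))) =
            P + (m + (-m / (m' - m)) * (m' - m)) • (P' - P) := by module
        rw [this, div_mul_cancel₀ _ hpos.ne']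
        simp
      obtain ⟨f, hf⟩ := hlin (-(P' 0 - P 0)) (-(P' 1 - P 1))
      have hfd : f (P' - P) < 0 := by
        rw [hf]
        simp only [PiLp.sub_apply]
        by_contra hc
        exact hP (plane_ext
          (by nlinarith [sq_nonneg (P' 0 - P 0), sq_nonneg (P' 1 - P 1)])
          (by nlinarith [sq_nonneg (P' 0 - P 0), sq_nonneg (P' 1 - P 1)]))
      refine ⟨f, ?_, hfd.le, ?_⟩
      · rw [hm, map_add, map_smul, smul_eq_mul]
        nlinarith
      · have : Q' - Q = (m' - m) • (P' - P) := by rw [hm, hm']; module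
        rw [this, map_smul, smul_eq_mul]
        nlinarith
    -- Distinct parallel lines: `f` is constant along both, and the factor `u` makes `f Q - f P`
    -- equal to `u * u`.
    · obtain ⟨f, hf⟩ := hlin (-(P' 1 - P 1) * u) ((P' 0 - P 0) * u)
      refine ⟨f, ?_, ?_, ?_⟩
      · have : f Q - f P = u * u := by rw [hf, hf]; simp only [hu, signedArea]; ring
        have := mul_self_pos.2 h1
        linarith
      · rw [hf]; simp only [PiLp.sub_apply]; apply le_of_eq; ring
      · have : f (Q' - Q) = u * D := by rw [hf]; simp only [hD, PiLp.sub_apply]; ring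
        rw [this, h0, mul_zero]
  · -- `Q - P = x • (P' - P) - y • (Q' - Q)` with `x < 0` or `y < 0`
    set x := ((Q 0 - P 0) * (Q' 1 - Q 1) - (Q 1 - P 1) * (Q' 0 - Q 0)) / D with hx
    set y := ((Q 0 - P 0) * (P' 1 - P 1) - (Q 1 - P 1) * (P' 0 - P 0)) / D with hy
    have key : P + x • (P' - P) = Q + y • (Q' - Q) := by
      apply plane_ext <;>
        simp only [PiLp.add_apply, PiLp.smul_apply, PiLp.sub_apply, smul_eq_mul, hx, hy] <;>
        field_simp <;> simp only [hD] <;> ring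
    rcases lt_or_ge x 0 with h1 | h1
    -- This functional is 0 on `Q' - Q` and -1 on `P' - P`, hence `-x` on `Q - P`. The functional of
    -- the other case is 0 on `P' - P` and 1 on `Q' - Q`, hence `-y` on `Q - P`.
    · obtain ⟨f, hf⟩ := hlin (-(Q' 1 - Q 1) / D) ((Q' 0 - Q 0) / D)
      refine ⟨f, ?_, ?_, ?_⟩
      · have : f Q - f P = -x := by rw [hf, hf]; simp only [hx]; field_simp; ring
        linarith
      · have : f (P' - P) = -1 := by
          rw [hf]; simp only [PiLp.sub_apply]; field_simp; simp only [hD]; ring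
        linarith
      · apply le_of_eq; rw [hf]; simp only [PiLp.sub_apply]; field_simp; ring
    · have h2 : y < 0 := by
        by_contra hn
        exact hd x y h1 (not_lt.1 hn) key
      obtain ⟨f, hf⟩ := hlin (-(P' 1 - P 1) / D) ((P' 0 - P 0) / D)
      refine ⟨f, ?_, ?_, ?_⟩
      · have : f Q - f P = -y := by rw [hf, hf]; simp only [hy]; field_simp; ring
        linarith
      · apply le_of_eq; rw [hf]; simp only [PiLp.sub_apply]; field_simp; ring
      · have : f (Q' - Q) = 1 := by
          rw [hf]; simp only [PiLp.sub_apply]; field_simp; simp only [hD]; ring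
        linarith

theorem convex_le (f : Plane →ₗ[ℝ] ℝ) (s : ℝ) : Convex ℝ {Z | f Z ≤ s} :=
  convex_halfSpace_le f.isLinear s

theorem convex_ge (f : Plane →ₗ[ℝ] ℝ) (s : ℝ) : Convex ℝ {Z | s ≤ f Z} :=
  convex_halfSpace_ge f.isLinear s

theorem crossNumber_eq_zero_of_convex {K : Set Plane} (hK : Convex ℝ K) {P P' A B : Plane}
    (hKP : ∀ Z ∈ ray P P', Z ∉ K) (hA : A ∈ K) (hB : B ∈ K) : crossNumber P P' A B = 0 := by
  by_contra hn
  obtain ⟨W, hW, hW'⟩ := exists_mem_segment_ray_of_crossNumber_ne_zero hn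
  exact hKP W hW' (hK.segment_subset hA hB hW)

/-! ### The value of a segment -/

/-- The element of the free group read off from a segment; every point of the plane is allowed
as an end point. -/
noncomputable def segVal (f : Plane →ₗ[ℝ] ℝ) (P P' Q Q' A B : Plane) : FreeGroup (Fin 2) :=
  -- When the rays lie in `f < s` and `s < f`, a segment along which `f` increases can only meet
  -- `PP'` before `QQ'`. If `f A = f B`, one exponent is 0 and the order does not matter.
  if f A ≤ f B then
    FreeGroup.of 0 ^ crossNumber P P' A B * FreeGroup.of 1 ^ crossNumber Q Q' A B
  else FreeGroup.of 1 ^ crossNumber Q Q' A B * FreeGroup.of 0 ^ crossNumber P P' A B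

section
variable {f : Plane →ₗ[ℝ] ℝ} {s : ℝ} {P P' Q Q' A B C : Plane}

theorem Separates.crossNumber_left (h : Separates f s P P' Q Q') (hA : s ≤ f A) (hB : s ≤ f B) :
    crossNumber P P' A B = 0 :=
  crossNumber_eq_zero_of_convex (convex_ge f s) (fun Z hZ => not_le.2 (h.1 Z hZ)) hA hB

theorem Separates.crossNumber_right (h : Separates f s P P' Q Q') (hA : f A ≤ s) (hB : f B ≤ s) :
    crossNumber Q Q' A B = 0 :=
  crossNumber_eq_zero_of_convex (convex_le f s) (fun Z hZ => not_le.2 (h.2 Z hZ)) hA hB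

theorem Separates.segVal_left (h : Separates f s P P' Q Q') (hA : f A ≤ s) (hB : f B ≤ s) :
    segVal f P P' Q Q' A B = FreeGroup.of 0 ^ crossNumber P P' A B := by
  simp [segVal, h.crossNumber_right hA hB]

theorem Separates.segVal_right (h : Separates f s P P' Q Q') (hA : s ≤ f A) (hB : s ≤ f B) :
    segVal f P P' Q Q' A B = FreeGroup.of 1 ^ crossNumber Q Q' A B := by
  simp [segVal, h.crossNumber_left hA hB]

theorem Separates.segVal_swap (h : Separates f s P P' Q Q') :
    segVal f P P' Q Q' B A = (segVal f P P' Q Q' A B)⁻¹ := by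
  rcases lt_trichotomy (f A) (f B) with hlt | heq | hlt
  · simp [segVal, hlt.le, hlt.not_ge, crossNumber_swap _ _ A B]
  · rcases le_total (f A) s with h' | h'
    · rw [h.segVal_left (heq ▸ h') h', h.segVal_left h' (heq ▸ h'), crossNumber_swap, zpow_neg]
    · rw [h.segVal_right (heq ▸ h') h', h.segVal_right h' (heq ▸ h'), crossNumber_swap, zpow_neg]
  · simp [segVal, hlt.le, hlt.not_ge, crossNumber_swap _ _ A B]

/-- If `f A ≤ f B ≤ f C`, the product has the shape `a^p b^q a^p' b^q'`. Depending on the side of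
`B`, either `q = 0` or `p' = 0`, so the powers merge and additivity of the crossing numbers applies.
The other orders follow by permuting the vertices and inverting. -/
theorem Separates.segVal_mul (h : Separates f s P P' Q Q')
    (hN : convexHull ℝ ({A, B, C} : Set Plane) ⊆ {P, Q}ᶜ) :
    segVal f P P' Q Q' A B * segVal f P P' Q Q' B C = segVal f P P' Q Q' A C := by
  have mono : ∀ {A B C : Plane}, convexHull ℝ ({A, B, C} : Set Plane) ⊆ {P, Q}ᶜ → f A ≤ f B →
      f B ≤ f C → segVal f P P' Q Q' A B * segVal f P P' Q Q' B C = segVal f P P' Q Q' A C := by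
    intro A B C hN hAB hBC
    have hP := crossNumber_add (P' := P') (fun hh => hN hh (by simp) :
      P ∉ convexHull ℝ ({A, B, C} : Set Plane))
    have hQ := crossNumber_add (P' := Q') (fun hh => hN hh (by simp) :
      Q ∉ convexHull ℝ ({A, B, C} : Set Plane))
    simp only [segVal, hAB, hBC, hAB.trans hBC, if_true, ← hP, ← hQ, zpow_add]
    rcases le_total (f B) s with hB | hB
    · simp [h.crossNumber_right (hAB.trans hB) hB, mul_assoc]
    · simp [h.crossNumber_left hB (hB.trans hBC), mul_assoc]
  have perm : ∀ {A' B' C' : Plane}, ({A, B, C} : Set Plane) = {A', B', C'} → f A' ≤ f B' →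
      f B' ≤ f C' → segVal f P P' Q Q' A' B' * segVal f P P' Q Q' B' C' =
        segVal f P P' Q Q' A' C' := by
    intro A' B' C' e; rw [e] at hN; exact mono hN
  have e1 := h.segVal_swap (A := A) (B := B)
  have e2 := h.segVal_swap (A := B) (B := C)
  have e3 := h.segVal_swap (A := A) (B := C)
  have desc : f B ≤ f A → f C ≤ f B →
      segVal f P P' Q Q' A B * segVal f P P' Q Q' B C = segVal f P P' Q Q' A C := by
    intro hAB hBC
    have := perm (A' := C) (B' := B) (C' := A) (by ext; simp; tauto) hBC hAB
    rw [e1, e2, e3] at this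
    rw [← inv_inv (segVal f P P' Q Q' A C), ← this]; simp
  rcases le_total (f A) (f B) with hAB | hAB <;> rcases le_total (f B) (f C) with hBC | hBC <;>
    rcases le_total (f A) (f C) with hAC | hAC
  · exact mono hN hAB hBC
  · exact mono hN hAB hBC
  · have := perm (A' := A) (B' := C) (C' := B) (by ext; simp; tauto) hAC hBC
    rw [← this, e2]; simp
  · have := perm (A' := C) (B' := A) (C' := B) (by ext; simp; tauto) hAC hAB
    rw [e2, e3] at this
    rw [← inv_inv (segVal f P P' Q Q' B C), ← this]; simp
  · have := perm (A' := B) (B' := A) (C' := C) (by ext; simp; tauto) hAB hAC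
    rw [← this, e1]; simp
  · have := perm (A' := B) (B' := C) (C' := A) (by ext; simp; tauto) hBC hAC
    rw [e1, e3] at this
    rw [← inv_inv (segVal f P P' Q Q' A B), ← this]; simp
  · exact desc hAB hBC
  · exact desc hAB hBC

theorem Separates.mk_segmentWord (h : Separates f s P P' Q Q') (hP : P' ≠ P) (hQ : Q' ≠ Q)
    (hN : segment ℝ A B ⊆ {P, Q}ᶜ) (hAP : A ∉ ray P P') (hAQ : A ∉ ray Q Q')
    (hBP : B ∉ ray P P') (hBQ : B ∉ ray Q Q') :
    FreeGroup.mk (segmentWord P P' Q Q' A B) = segVal f P P' Q Q' A B := by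
  have cP := mk_crossing 0 hP hAP hBP (fun hh => hN hh (by simp))
  have cQ := mk_crossing 1 hQ hAQ hBQ (fun hh => hN hh (by simp))
  unfold segmentWord segVal
  rw [← cP, ← cQ]
  by_cases hU : (segment ℝ A B ∩ ray P P').Nonempty; swap
  · have : crossing 0 P P' A B = [] := by simp [crossing, hU]
    simp [this, ← FreeGroup.one_eq_mk]
  by_cases hV : (segment ℝ A B ∩ ray Q Q').Nonempty; swap
  · have : crossing 1 Q Q' A B = [] := by simp [crossing, hV]
    simp [this, ← FreeGroup.one_eq_mk]
  -- The order matters only if both rays are met; then `f` takes a smaller value at `U` than at `V`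
  -- and is affine along the segment, so it decides which comes first.
  have key : (∃ U ∈ segment ℝ A B ∩ ray P P', ∃ V ∈ segment ℝ A B ∩ ray Q Q', U ∈ segment ℝ A V) ↔
      f A ≤ f B := by
    constructor
    · rintro ⟨U, ⟨-, hU⟩, V, ⟨hV, hV'⟩, hUV⟩
      have h1 := h.1 U hU
      have h2 := h.2 V hV'
      by_contra hlt
      have h3 : f V ≤ f A := (convex_le f (f A)).segment_subset (x := A) (y := B)
        (Set.mem_ofPred.2 le_rfl) (not_le.1 hlt).le hV
      have h4 : f V ≤ f U := (convex_ge f (f V)).segment_subset (x := A) (y := V) h3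
        (Set.mem_ofPred.2 le_rfl) hUV
      linarith
    · intro hle
      obtain ⟨U, hU, hU'⟩ := hU
      obtain ⟨V, hV, hV'⟩ := hV
      refine ⟨U, ⟨hU, hU'⟩, V, ⟨hV, hV'⟩, ?_⟩
      have h1 := h.1 U hU'
      have h2 := h.2 V hV'
      rw [segment_eq_image_lineMap] at hU hV
      obtain ⟨x, hx, rfl⟩ := hU
      obtain ⟨y, hy, rfl⟩ := hV
      have hf : ∀ t : ℝ, f (AffineMap.lineMap A B t) = f A + t * (f B - f A) := by
        intro t; simp [AffineMap.lineMap_apply]; ring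
      rw [hf] at h1 h2
      have hxy : x < y := by
        by_contra hn
        nlinarith
      have hy0 : 0 < y := hx.1.trans_lt hxy
      rw [segment_eq_image_lineMap]
      refine ⟨x / y, ⟨div_nonneg hx.1 hy0.le, (div_le_one hy0).2 hxy.le⟩, ?_⟩
      simp [AffineMap.lineMap_apply, smul_smul, div_mul_cancel₀ _ hy0.ne']
  by_cases hle : f A ≤ f B
  · rw [if_pos hle, if_pos (key.2 hle)]; rfl
  · rw [if_neg hle, if_neg (mt key.1 hle)]; rfl

end
/-! ### Cocycles near a puncture -/

theorem convexHull_subset_segment {A B W : Plane} (h : W ∈ segment ℝ A B) :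
    convexHull ℝ ({A, W, B} : Set Plane) ⊆ segment ℝ A B := by
  refine convexHull_min ?_ (convex_segment A B)
  rintro _ (rfl | rfl | rfl)
  exacts [left_mem_segment _ _ _, h, right_mem_segment _ _ _]

theorem not_mem_segment_of_mem_ray {P P' W W' : Plane} (hP : P' ≠ P) (hW : W ∈ ray P P')
    (hW' : W' ∈ ray P P') (h : W ≠ P) (h' : W' ≠ P) : P ∉ segment ℝ W W' := by
  obtain ⟨t, ht, rfl⟩ := hW
  obtain ⟨t', ht', rfl⟩ := hW'
  have ht0 : 0 < t := ht.lt_of_ne (by rintro rfl; simp at h)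
  have ht0' : 0 < t' := ht'.lt_of_ne (by rintro rfl; simp at h')
  rintro ⟨a, b, ha, hb, hab, e⟩
  have h3 : (a * t + b * t') • (P' - P) = 0 := by
    obtain rfl : a = 1 - b := by linarith
    have := sub_eq_zero.2 e
    rw [← this]; module
  rcases smul_eq_zero.1 h3 with h | h
  · rcases ha.eq_or_lt with rfl | ha'
    · obtain rfl : b = 1 := by linarith
      linarith
    · have := mul_pos ha' ht0
      have := mul_nonneg hb ht
      have := mul_nonneg hb ht0'.le
      linarith
  · exact hP (sub_eq_zero.1 h)

theorem mem_segment_of_opposite {P P' : Plane} {x y : ℝ} (hx : x < 0) (hy : 0 ≤ y) :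
    P ∈ segment ℝ (P + x • (P' - P)) (P + y • (P' - P)) := by
  have hD : 0 < y - x := by linarith
  refine ⟨y / (y - x), -x / (y - x), by positivity, div_nonneg (by linarith) hD.le,
    by field_simp; ring, ?_⟩
  apply plane_ext <;>
    simp only [PiLp.add_apply, PiLp.smul_apply, PiLp.sub_apply, smul_eq_mul] <;> field_simp <;>
    ring

/-- Reference points for a ray: a point `P - r • (P' - P)` on the opposite ray, the point
`P + r • (P' - P)` on the ray, and the points `Y`, `Y'` to the left and to the right. -/
structure Reference (P P' : Plane) (K : Set Plane) where
  r : ℝ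
  Y : Plane
  Y' : Plane
  r_pos : 0 < r
  back_mem : P - r • (P' - P) ∈ K
  forward_mem : P + r • (P' - P) ∈ K
  Y_mem : Y ∈ K
  Y'_mem : Y' ∈ K
  Y_pos : 0 < signedArea P P' Y
  Y'_neg : signedArea P P' Y' < 0
  crosses : signedArea Y Y' P < 0
  not_crosses : signedArea Y' (P - r • (P' - P)) P < 0

theorem exists_reference {P P' : Plane} {K : Set Plane} (hP : P' ≠ P) (hK : K ∈ nhds P) :
    Nonempty (Reference P P' K) := by
  have hd : 0 < (P' 0 - P 0) ^ 2 + (P' 1 - P 1) ^ 2 := by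
    by_contra hc
    exact hP (plane_ext
      (by nlinarith [sq_nonneg (P' 0 - P 0), sq_nonneg (P' 1 - P 1)])
      (by nlinarith [sq_nonneg (P' 0 - P 0), sq_nonneg (P' 1 - P 1)]))
  -- The direction of the ray turned by a left quarter turn. `Y` and `Y'` are displaced from `P`
  -- forward and to the left, respectively right, with a common small factor `r` that puts all four
  -- points in `K`.
  set ν : Plane := !₂[-(P' 1 - P 1), P' 0 - P 0] with hν
  have ev : ∀ v : Plane, ∀ᶠ r : ℝ in nhdsWithin 0 (Set.Ioi 0), P + r • v ∈ K := by
    intro v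
    have hc : Continuous fun r : ℝ => P + r • v := by fun_prop
    have := hc.tendsto 0
    simp only [zero_smul, add_zero] at this
    exact (this.eventually hK).filter_mono nhdsWithin_le_nhds
  obtain ⟨r, ⟨⟨⟨h1, h2⟩, h3⟩, h4⟩, hr⟩ := ((((ev (-(P' - P))).and (ev (P' - P))).and
    (ev (P' - P + ν))).and (ev (P' - P - ν))).and self_mem_nhdsWithin |>.exists
  have hr : 0 < r := hr
  have hpos := mul_pos hr hd
  have hpos2 := mul_pos hr hpos
  refine ⟨⟨r, P + r • (P' - P + ν), P + r • (P' - P - ν), hr, by simpa [sub_eq_add_neg] using h1,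
    h2, h3, h4, ?_, ?_, ?_, ?_⟩⟩ <;>
    simp only [signedArea, hν, PiLp.add_apply, PiLp.smul_apply, PiLp.sub_apply, smul_eq_mul,
      Matrix.cons_val_zero, Matrix.cons_val_one] <;> nlinarith

section
variable {G : Type*} [Group G] {g : Plane → Plane → G} {K : Set Plane} {P P' A B C : Plane}

/-- `g` is a cocycle on `K` with the point `P` removed. -/
def CocycleOn (g : Plane → Plane → G) (K : Set Plane) (P : Plane) : Prop :=
  ∀ ⦃A B C⦄, A ∈ K → B ∈ K → C ∈ K → P ∉ convexHull ℝ ({A, B, C} : Set Plane) →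
    g A B * g B C = g A C

theorem CocycleOn.self (hg : CocycleOn g K P) (hA : A ∈ K) (h : A ≠ P) : g A A = 1 := by
  simpa using hg hA hA hA (by simpa using h.symm)

theorem CocycleOn.swap (hg : CocycleOn g K P) (hA : A ∈ K) (hB : B ∈ K)
    (h : P ∉ segment ℝ A B) : g B A = (g A B)⁻¹ := by
  have h1 : P ∉ convexHull ℝ ({A, B, A} : Set Plane) := by
    have : ({A, B, A} : Set Plane) = {A, B} := by ext; simp; tauto
    rwa [this, convexHull_pair]
  have hne : A ≠ P := by rintro rfl; exact h (left_mem_segment _ _ _)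
  exact eq_inv_of_mul_eq_one_right ((hg hA hB hA h1).trans (hg.self hA hne))

theorem CocycleOn.via (hg : CocycleOn g K P) (hA : A ∈ K) (hB : B ∈ K) (hC : C ∈ K)
    (h : P ∉ convexHull ℝ ({A, B, C} : Set Plane)) : g A C * g C B = g A B := by
  refine hg hA hC hB ?_
  have : ({A, C, B} : Set Plane) = {A, B, C} := by ext; simp; tauto
  rwa [this]

open Classical in
/-- The potential of a cocycle: its value along a standard path from the opposite ray. -/
noncomputable def potential (g : Plane → Plane → G) (P P' Z Y A : Plane) : G :=
  if A ∈ ray P P' then g Z Y * g Y A else g Z A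

/-- The value of a cocycle on a loop around `P`. -/
def Reference.holonomy (g : Plane → Plane → G) (R : Reference P P' K) : G :=
  g (P - R.r • (P' - P)) R.Y * g R.Y (P + R.r • (P' - P)) *
    (g (P + R.r • (P' - P)) R.Y' * g R.Y' (P - R.r • (P' - P)))

/-- Cut `K` along the ray. The rest is star-shaped around the back point, so the value from there is
a potential for `g`. On the ray the potential is continued from the left, through `Y`. Only passages
between the ray and its right side then contribute a power of the holonomy, and `crossNumber` counts
exactly these. -/
theorem CocycleOn.eq_potential (hP : P' ≠ P) (hK : Convex ℝ K) (hg : CocycleOn g K P)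
    (R : Reference P P' K) (hA : A ∈ K) (hB : B ∈ K) (hAB : P ∉ segment ℝ A B) :
    g A B = (potential g P P' (P - R.r • (P' - P)) R.Y A)⁻¹ *
      R.holonomy g ^ crossNumber P P' A B * potential g P P' (P - R.r • (P' - P)) R.Y B := by
  obtain ⟨r, Y, Y', hr, hZ, hW₀, hY, hY', hYu, hYu', -, -⟩ := R
  simp only [Reference.holonomy]
  have hd0 : P' - P ≠ 0 := sub_ne_zero.2 hP
  have hZP : P - r • (P' - P) ≠ P := by simp [hr.ne', hd0]
  have hW₀P : P + r • (P' - P) ≠ P := by simp [hr.ne', hd0]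
  have hZu : signedArea P P' (P - r • (P' - P)) = 0 := by
    have := signedArea_ray P P' (-r)
    rwa [neg_smul, ← sub_eq_add_neg] at this
  have hW₀u : signedArea P P' (P + r • (P' - P)) = 0 := signedArea_ray P P' r
  have hW₀r : P + r • (P' - P) ∈ ray P P' := ⟨r, hr.le, rfl⟩
  have hZr : P - r • (P' - P) = P + (-r) • (P' - P) := by rw [neg_smul, sub_eq_add_neg]
  have disj : ∀ A B, A ∈ K → B ∈ K → (∀ V ∈ segment ℝ A B, V ∉ ray P P') →
      g (P - r • (P' - P)) A * g A B = g (P - r • (P' - P)) B := fun A B hA hB h =>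
    hg hZ hA hB (not_mem_convexHull_of_disjoint_ray hP hr h)
  generalize P - r • (P' - P) = Z at *
  generalize P + r • (P' - P) = W₀ at *
  have hW : ∀ W ∈ ray P P', signedArea P P' W = 0 := by
    rintro _ ⟨t, -, rfl⟩; exact signedArea_ray P P' t
  set α := g Z Y * g Y W₀ * (g W₀ Y' * g Y' Z) with hα
  set h := potential g P P' Z Y with hh
  -- from a point off the ray to a point on the ray
  have mixed : ∀ A W, A ∈ K → W ∈ K → A ∉ ray P P' → W ∈ ray P P' → P ∉ segment ℝ A W →
      g A W = (h A)⁻¹ * α ^ crossNumber P P' A W * h W := by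
    intro A W hA hWK hAr hWr hAW
    have hhA : h A = g Z A := if_neg hAr
    have hhW : h W = g Z Y * g Y W := if_pos hWr
    have hWu := hW W hWr
    have hWP : W ≠ P := by rintro rfl; exact hAW (right_mem_segment _ _ _)
    have hAP : A ≠ P := by rintro rfl; exact hAW (left_mem_segment _ _ _)
    rcases lt_trichotomy (signedArea P P' A) 0 with hu | hu | hu
    · have hn : crossNumber P P' A W = -1 := by
        rw [crossNumber_of_neg_of_nonneg hu hWu.ge, if_pos]
        obtain ⟨t, ht, rfl⟩ := hWr
        have ht0 : 0 < t := ht.lt_of_ne (by rintro rfl; simp at hWP)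
        have : signedArea A (P + t • (P' - P)) P = -t * signedArea P P' A := by
          simp only [signedArea, PiLp.add_apply, PiLp.smul_apply, PiLp.sub_apply, smul_eq_mul]
          ring
        rw [this]; nlinarith
      -- The triangles `W A Y'`, `Z A Y'`, `W₀ W Y'` and `W₀ W Y` avoid `P`. They carry the
      -- comparison from `A` and `W` to the reference points through which `α` is defined.
      have e1 : g W A * g A Y' = g W Y' := hg hWK hA hY'
        (not_mem_convexHull_of_neg hYu' hWu.le hu.le (by rwa [segment_symm]))
      have e2 : g Z A * g A Y' = g Z Y' := hg hZ hA hY'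
        (not_mem_convexHull_of_neg hYu' hZu.le hu.le (not_mem_segment_of_neg hu hZu.le hZP))
      have e3 : g W₀ W * g W Y' = g W₀ Y' := hg hW₀ hWK hY'
        (not_mem_convexHull_of_neg hYu' hW₀u.le hWu.le
          (not_mem_segment_of_mem_ray hP hW₀r hWr hW₀P hWP))
      have e4 : g W₀ W * g W Y = g W₀ Y := hg hW₀ hWK hY
        (not_mem_convexHull_of_pos hYu hW₀u.ge hWu.ge
          (not_mem_segment_of_mem_ray hP hW₀r hWr hW₀P hWP))
      rw [hg.swap hA hWK hAW] at e1
      rw [hg.swap hY hWK (by rw [segment_symm]; exact not_mem_segment_of_pos hYu hWu.ge hWP),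
        hg.swap hY hW₀ (by rw [segment_symm]; exact not_mem_segment_of_pos hYu hW₀u.ge hW₀P)] at e4
      have e5 : g Y' Z = (g Z Y')⁻¹ := hg.swap hZ hY' (not_mem_segment_of_neg hYu' hZu.le hZP)
      rw [hn, hhA, hhW, hα, e5, ← e2, ← e3, ← e1]
      have : g W₀ W = (g Y W₀)⁻¹ * g Y W := by rw [← e4]; group
      rw [this]
      group
    · exfalso
      obtain ⟨x, rfl⟩ := exists_of_signedArea_eq_zero hP hu
      have hx : x < 0 := by
        by_contra hx
        exact hAr ⟨x, not_lt.1 hx, rfl⟩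
      obtain ⟨y, hy, rfl⟩ := hWr
      exact hAW (mem_segment_of_opposite hx hy)
    · rw [crossNumber_eq_zero hu.le hWu.ge, hhA, hhW]
      have e1 : g Z A * g A Y = g Z Y := hg hZ hA hY (not_mem_convexHull_of_pos hYu hZu.ge hu.le
        (not_mem_segment_of_pos hu hZu.ge hZP))
      have e2 : g A Y * g Y W = g A W := hg.via hA hWK hY
        (not_mem_convexHull_of_pos hYu hu.le hWu.ge hAW)
      rw [← e2, ← e1]; group
  have mixed' : ∀ W A, W ∈ K → A ∈ K → W ∈ ray P P' → A ∉ ray P P' → P ∉ segment ℝ W A →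
      g W A = (h W)⁻¹ * α ^ crossNumber P P' W A * h A := by
    intro W A hWK hA hWr hAr hWA
    rw [segment_symm] at hWA
    rw [hg.swap hA hWK hWA, mixed A W hA hWK hAr hWr hWA, crossNumber_swap P P' A W]
    group
  by_cases hAr : A ∈ ray P P' <;> by_cases hBr : B ∈ ray P P'
  · have hAu := hW A hAr
    have hBu := hW B hBr
    rw [crossNumber_eq_zero hAu.ge hBu.ge]
    have hhA : h A = g Z Y * g Y A := if_pos hAr
    have hhB : h B = g Z Y * g Y B := if_pos hBr
    have hAP : A ≠ P := by rintro rfl; exact hAB (left_mem_segment _ _ _)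
    have e1 : g A Y * g Y B = g A B :=
      hg.via hA hB hY (not_mem_convexHull_of_pos hYu hAu.ge hBu.ge hAB)
    rw [hg.swap hY hA (by rw [segment_symm]; exact not_mem_segment_of_pos hYu hAu.ge hAP)] at e1
    rw [← e1, hhA, hhB]; group
  · exact mixed' A B hA hB hAr hBr hAB
  · exact mixed A B hA hB hAr hBr hAB
  · by_cases hV : ∀ V ∈ segment ℝ A B, V ∉ ray P P'
    · have hn : crossNumber P P' A B = 0 := by
        by_contra hn
        obtain ⟨V, hV1, hV2⟩ := exists_mem_segment_ray_of_crossNumber_ne_zero hn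
        exact hV V hV1 hV2
      have hhA : h A = g Z A := if_neg hAr
      have hhB : h B = g Z B := if_neg hBr
      rw [hn, hhA, hhB, ← disj A B hA hB hV]; group
    -- A segment that meets the ray at `W` is cut there; the degenerate triangle `A W B` makes both
    -- sides multiplicative.
    · push Not at hV
      obtain ⟨W, hW1, hW2⟩ := hV
      have hsub := convexHull_subset_segment hW1
      have hPn : P ∉ convexHull ℝ ({A, W, B} : Set Plane) := fun hh => hAB (hsub hh)
      have hWK := hK.segment_subset hA hB hW1
      rw [← hg hA hWK hB hPn, ← crossNumber_add hPn,
        mixed A W hA hWK hAr hW2 fun hh => hPn (segment_subset_convexHull_left hh),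
        mixed' W B hWK hB hW2 hBr fun hh => hPn (segment_subset_convexHull_right hh)]
      group

end

/-! ### Cocycles on the plane with two punctures -/

section
variable {f : Plane →ₗ[ℝ] ℝ} {s : ℝ} {P P' Q Q' : Plane}

theorem exists_apply_eq {A B : Plane} (h : f A < f B) (s : ℝ) : ∃ O, f O = s := by
  have hne : f B - f A ≠ 0 := (sub_pos.2 h).ne'
  refine ⟨A + ((s - f A) / (f B - f A)) • (B - A), ?_⟩
  rw [map_add, map_smul, map_sub, smul_eq_mul, div_mul_cancel₀ _ hne]; ring

theorem Separates.nonempty_reference_left (hs : Separates f s P P' Q Q') (hP : P' ≠ P) :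
    Nonempty (Reference P P' {Z | f Z ≤ s}) :=
  exists_reference hP ((f.continuous_of_finiteDimensional.continuousAt.eventually_lt
    continuousAt_const (hs.1 P (origin_mem_ray P P'))).mono fun _ h => h.le)

theorem Separates.nonempty_reference_right (hs : Separates f s P P' Q Q') (hQ : Q' ≠ Q) :
    Nonempty (Reference Q Q' {Z | s ≤ f Z}) :=
  exists_reference hQ ((continuousAt_const.eventually_lt
    f.continuous_of_finiteDimensional.continuousAt (hs.2 Q (origin_mem_ray Q Q'))).mono
    fun _ h => h.le)

end

/-- Every cocycle on the complement of `{P, Q}` is, up to a coboundary, the image of the universal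
one under a homomorphism. -/
theorem exists_hom_of_cocycle {G : Type*} [Group G] {g : Plane → Plane → G}
    {f : Plane →ₗ[ℝ] ℝ} {s : ℝ} {P P' Q Q' : Plane} (hs : Separates f s P P' Q Q')
    (hP : P' ≠ P) (hQ : Q' ≠ Q)
    (hg : ∀ A B C, convexHull ℝ ({A, B, C} : Set Plane) ⊆ {P, Q}ᶜ → g A B * g B C = g A C) :
    ∃ (ψ : FreeGroup (Fin 2) →* G) (h : Plane → G), ∀ A B, segment ℝ A B ⊆ {P, Q}ᶜ →
      g A B = (h A)⁻¹ * ψ (segVal f P P' Q Q' A B) * h B := by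
  have hPs := hs.1 P (origin_mem_ray P P')
  have hQs := hs.2 Q (origin_mem_ray Q Q')
  -- A triangle in this half-plane cannot contain `Q`, so only the puncture `P` matters. The other
  -- half-plane is symmetric.
  have hg1 : CocycleOn g {Z | f Z ≤ s} P := by
    intro A B C hA hB hC h
    refine hg A B C fun V hV => ?_
    rintro (rfl | rfl)
    · exact h hV
    · refine absurd (convexHull_min ?_ (convex_le f s) hV : f V ≤ s) (not_le.2 hQs)
      rintro _ (rfl | rfl | rfl) <;> assumption
  have hg2 : CocycleOn g {Z | s ≤ f Z} Q := by
    intro A B C hA hB hC h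
    refine hg A B C fun V hV => ?_
    rintro (rfl | rfl)
    · refine absurd (convexHull_min ?_ (convex_ge f s) hV : s ≤ f V) (not_le.2 hPs)
      rintro _ (rfl | rfl | rfl) <;> assumption
    · exact h hV
  obtain ⟨R1⟩ := hs.nonempty_reference_left hP
  obtain ⟨R2⟩ := hs.nonempty_reference_right hQ
  have E1 := fun A B hA hB => hg1.eq_potential hP (convex_le f s) R1 (A := A) (B := B) hA hB
  have E2 := fun A B hA hB => hg2.eq_potential hQ (convex_ge f s) R2 (A := A) (B := B) hA hB
  generalize potential g P P' _ _ = h1 at E1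
  generalize potential g Q Q' _ _ = h2 at E2
  generalize R1.holonomy g = α at E1
  generalize R2.holonomy g = β at E2
  -- a point of the common boundary
  obtain ⟨O, hO⟩ := exists_apply_eq (hPs.trans hQs) s
  set k := h1 O * (h2 O)⁻¹ with hk
  -- Along the line `f = s` both crossing numbers vanish, so `h1` and `h2` both have `g` as their
  -- quotient there and differ by a constant left factor.
  have hline : ∀ M, f M = s → h1 M = k * h2 M := by
    intro M hM
    have hOP : P ∉ segment ℝ O M := fun hh =>
      absurd ((convex_ge f s).segment_subset hO.ge hM.ge hh : s ≤ f P) (not_le.2 hPs)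
    have hOQ : Q ∉ segment ℝ O M := fun hh =>
      absurd ((convex_le f s).segment_subset hO.le hM.le hh : f Q ≤ s) (not_le.2 hQs)
    have e1 := E1 O M hO.le hM.le hOP
    have e2 := E2 O M hO.ge hM.ge hOQ
    rw [hs.crossNumber_left hO.ge hM.ge] at e1
    rw [hs.crossNumber_right hO.le hM.le, e1] at e2
    simp only [zpow_zero, mul_one] at e2
    rw [hk, mul_assoc, ← e2, mul_inv_cancel_left]
  classical
  -- Multiplying `h2` by `k` makes the potentials agree on the common line, at the price of
  -- conjugating the second holonomy.
  let ψ : FreeGroup (Fin 2) →* G := FreeGroup.lift ![α, k * β * k⁻¹]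
  let h : Plane → G := fun A => if f A ≤ s then h1 A else k * h2 A
  have hle : ∀ A, f A ≤ s → h A = h1 A := fun A hA => if_pos hA
  have hge : ∀ A, s ≤ f A → h A = k * h2 A := fun A hA => by
    rcases hA.eq_or_lt with e | e
    · rw [hle A e.ge, hline A e.symm]
    · exact if_neg (not_le.2 e)
  have F1 : ∀ A B, f A ≤ s → f B ≤ s → segment ℝ A B ⊆ {P, Q}ᶜ →
      g A B = (h A)⁻¹ * ψ (segVal f P P' Q Q' A B) * h B := by
    intro A B hA hB hN
    rw [hs.segVal_left hA hB, hle A hA, hle B hB, E1 A B hA hB fun hh => hN hh (by simp)]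
    simp [ψ]
  have F2 : ∀ A B, s ≤ f A → s ≤ f B → segment ℝ A B ⊆ {P, Q}ᶜ →
      g A B = (h A)⁻¹ * ψ (segVal f P P' Q Q' A B) * h B := by
    intro A B hA hB hN
    rw [hs.segVal_right hA hB, hge A hA, hge B hB, E2 A B hA hB fun hh => hN hh (by simp)]
    simp [ψ, conj_zpow]
    group
  have split : ∀ A B M, M ∈ segment ℝ A B → segment ℝ A B ⊆ {P, Q}ᶜ →
      (segment ℝ A M ⊆ {P, Q}ᶜ → g A M = (h A)⁻¹ * ψ (segVal f P P' Q Q' A M) * h M) →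
      (segment ℝ M B ⊆ {P, Q}ᶜ → g M B = (h M)⁻¹ * ψ (segVal f P P' Q Q' M B) * h B) →
      g A B = (h A)⁻¹ * ψ (segVal f P P' Q Q' A B) * h B := by
    intro A B M hM hN e1 e2
    have hsub := (convexHull_subset_segment hM).trans hN
    rw [← hg A M B hsub, ← hs.segVal_mul hsub,
      e1 (segment_subset_convexHull_left.trans hsub),
      e2 (segment_subset_convexHull_right.trans hsub), map_mul]
    group
  have exM : ∀ A B, f A ≤ s → s ≤ f B → f A < f B → ∃ M ∈ segment ℝ A B, f M = s := by
    intro A B hA hB hAB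
    have hpos : 0 < f B - f A := sub_pos.2 hAB
    refine ⟨_, ⟨(f B - s) / (f B - f A), (s - f A) / (f B - f A),
      div_nonneg (by linarith) hpos.le, div_nonneg (by linarith) hpos.le, by field_simp; ring, rfl⟩,
      ?_⟩
    simp only [map_add, map_smul, smul_eq_mul]
    field_simp; ring
  refine ⟨ψ, h, fun A B hN => ?_⟩
  rcases le_or_gt (f A) s with hA | hA <;> rcases le_or_gt (f B) s with hB | hB
  · exact F1 A B hA hB hN
  · obtain ⟨M, hM, hMs⟩ := exM A B hA hB.le (hA.trans_lt hB)
    exact split A B M hM hN (F1 A M hA hMs.le) (F2 M B hMs.ge hB.le)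
  · obtain ⟨M, hM, hMs⟩ := exM B A hB hA.le (hB.trans_lt hA)
    rw [segment_symm] at hM
    exact split A B M hM hN (F2 A M hA.le hMs.ge) (F1 M B hMs.le hB)
  · exact F2 A B hA.le hB.le hN

/-! ### Products along lists of points -/

/-- The product of the values of the successive edges of a list of points. -/
def listProd {G : Type*} [Monoid G] (v : Plane → Plane → G) : List Plane → G
  | [] => 1
  | [_] => 1
  | A :: B :: L => v A B * listProd v (B :: L)

section
variable {G : Type*} [Group G] (v : Plane → Plane → G)

theorem listProd_append (L : List Plane) (A : Plane) (R : List Plane) :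
    listProd v (L ++ A :: R) = listProd v (L ++ [A]) * listProd v (A :: R) := by
  induction L with
  | nil => simp [listProd]
  | cons B L ih =>
    cases L with
    | nil => simp [listProd]
    | cons C L =>
      simp only [List.cons_append, listProd] at ih ⊢
      rw [ih, mul_assoc]

theorem listProd_cancel {A B C : Plane} (h : v A B * v B C = v A C) (L R : List Plane) :
    listProd v (L ++ A :: B :: C :: R) = listProd v (L ++ A :: C :: R) := by
  rw [listProd_append, listProd_append v L A (C :: R)]
  simp [listProd, ← h, mul_assoc]

theorem listProd_reverse {v : Plane → Plane → G} (hv : ∀ A B, v B A = (v A B)⁻¹)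
    (L : List Plane) : listProd v L.reverse = (listProd v L)⁻¹ := by
  induction L with
  | nil => simp [listProd]
  | cons A L ih =>
    cases L with
    | nil => simp [listProd]
    | cons B L =>
      have : (A :: B :: L).reverse = L.reverse ++ B :: [A] := by simp
      rw [this, listProd_append, ← List.reverse_cons, ih]
      simp [listProd, hv A B]

/-- The factors `h` at the intermediate vertices telescope. -/
theorem listProd_coboundary {H : Type*} [Group H] {v : Plane → Plane → G} {g : Plane → Plane → H}
    {N : Set Plane} {ψ : G →* H} {h : Plane → H}
    (hg : ∀ A B, segment ℝ A B ⊆ N → g A B = (h A)⁻¹ * ψ (v A B) * h B) (A B : Plane)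
    (m : List Plane) (hm : (A :: m).IsChain fun A B => segment ℝ A B ⊆ N)
    (hB : (A :: m).getLast? = some B) :
    listProd g (A :: m) = (h A)⁻¹ * ψ (listProd v (A :: m)) * h B := by
  induction m generalizing A with
  | nil =>
    obtain rfl : A = B := by simpa using hB
    simp [listProd]
  | cons C m ih =>
    rw [List.isChain_cons_cons] at hm
    simp only [listProd]
    rw [ih C hm.2 (by simpa using hB), hg A C hm.1, map_mul]
    group

end

/-- Along a list of points off the rays, the word of the list represents the product. -/
theorem Separates.mk_pathWord {f : Plane →ₗ[ℝ] ℝ} {s : ℝ} {P P' Q Q' : Plane}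
    (hs : Separates f s P P' Q Q') (hP : P' ≠ P) (hQ : Q' ≠ Q) (L : List Plane)
    (hL : L.IsChain fun A B => segment ℝ A B ⊆ {P, Q}ᶜ)
    (hoff : ∀ V ∈ L, V ∉ ray P P' ∧ V ∉ ray Q Q') :
    FreeGroup.mk (pathWord P P' Q Q' L) = listProd (segVal f P P' Q Q') L := by
  induction L with
  | nil => rfl
  | cons A L ih =>
    cases L with
    | nil => rfl
    | cons B L =>
      rw [List.isChain_cons_cons] at hL
      have hA := hoff A (by simp)
      have hB := hoff B (by simp)
      simp only [pathWord, listProd]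
      rw [← FreeGroup.mul_mk, ih hL.2 fun V hV => hoff V (List.mem_cons_of_mem _ hV),
        hs.mk_segmentWord hP hQ hL.1 hA.1 hA.2 hB.1 hB.2]

/-! ### Routes with a given value -/

/-- There is a polygonal path in `N` from `A` to `B` with vertices in `S` and with value `w`. -/
def Route {G : Type*} [Monoid G] (N S : Set Plane) (v : Plane → Plane → G) (A B : Plane) (w : G) :
    Prop :=
  ∃ t : List Plane, (A :: (t ++ [B])).IsChain (fun A B => segment ℝ A B ⊆ N) ∧
    (∀ V ∈ A :: (t ++ [B]), V ∈ S) ∧ listProd v (A :: (t ++ [B])) = w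

section
variable {G : Type*} [Group G] {N S : Set Plane} {v : Plane → Plane → G} {A B C : Plane} {w w' : G}

theorem Route.edge (h : segment ℝ A B ⊆ N) (hA : A ∈ S) (hB : B ∈ S) : Route N S v A B (v A B) :=
  ⟨[], by simpa using h, by simp [hA, hB], by simp [listProd]⟩

theorem Route.trans (h : Route N S v A B w) (h' : Route N S v B C w') :
    Route N S v A C (w * w') := by
  obtain ⟨t, ht, hS, rfl⟩ := h
  obtain ⟨t', ht', hS', rfl⟩ := h'
  refine ⟨t ++ B :: t', ?_, ?_, ?_⟩
  · have := List.isChain_split (l₁ := A :: t).2 ⟨ht, ht'⟩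
    simpa using this
  · intro V hV
    simp only [List.mem_cons, List.mem_append, List.not_mem_nil, or_false] at hV hS hS'
    rcases hV with h | (h | h | h) | h
    · exact hS V (by tauto)
    · exact hS V (by tauto)
    · exact hS V (by tauto)
    · exact hS' V (by tauto)
    · exact hS' V (by tauto)
  · have := listProd_append v (A :: t) B (t' ++ [C])
    simpa using this

theorem Route.symm (hv : ∀ A B, v B A = (v A B)⁻¹) (h : Route N S v A B w) :
    Route N S v B A w⁻¹ := by
  obtain ⟨t, ht, hS, rfl⟩ := h
  have e : (A :: (t ++ [B])).reverse = B :: (t.reverse ++ [A]) := by simp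
  refine ⟨t.reverse, ?_, ?_, ?_⟩
  · rw [← e]; exact BasedLine.isChain_reverse ht
  · rw [← e]; intro V hV; exact hS V (List.mem_reverse.1 hV)
  · rw [← e, listProd_reverse hv]

variable {K : Set Plane} {P P' : Plane} {γ : G}

theorem Reference.back_not_mem_ray (hP : P' ≠ P) (R : Reference P P' K) :
    P - R.r • (P' - P) ∉ ray P P' := by
  rintro ⟨t, ht, e⟩
  have : (t + R.r) • (P' - P) = 0 := by
    have := sub_eq_zero.2 e
    rw [← neg_eq_zero, ← this]; module
  rcases smul_eq_zero.1 this with h | h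
  · have := R.r_pos
    linarith
  · exact hP (sub_eq_zero.1 h)

theorem Reference.signedArea_back (R : Reference P P' K) :
    signedArea P P' (P - R.r • (P' - P)) = 0 := by
  have := signedArea_ray P P' (-R.r)
  rwa [neg_smul, ← sub_eq_add_neg] at this

theorem Reference.Y_not_mem_ray (R : Reference P P' K) : R.Y ∉ ray P P' := by
  rintro ⟨t, ht, e⟩
  have := R.Y_pos
  rw [e, signedArea_ray] at this
  exact lt_irrefl _ this

theorem Reference.Y'_not_mem_ray (R : Reference P P' K) : R.Y' ∉ ray P P' := by
  rintro ⟨t, ht, e⟩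
  have := R.Y'_neg
  rw [e, signedArea_ray] at this
  exact lt_irrefl _ this

/-- The straight segment to the back point serves: as `A` is off the ray, it avoids `P` and has
crossing number 0. -/
theorem Reference.route_to_back (hP : P' ≠ P) (R : Reference P P' K)
    (hN : ∀ A B, A ∈ K → B ∈ K → P ∉ segment ℝ A B → segment ℝ A B ⊆ N)
    (hS : ∀ A ∈ K, A ∉ ray P P' → A ∈ S)
    (hv : ∀ A B, A ∈ K → B ∈ K → v A B = γ ^ crossNumber P P' A B)
    (hA : A ∈ K) (hA' : A ∉ ray P P') : Route N S v A (P - R.r • (P' - P)) 1 := by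
  have h1 : P ∉ segment ℝ A (P - R.r • (P' - P)) := by
    have := not_mem_convexHull_of_disjoint_ray (A := A) (B := A) hP R.r_pos (by simpa using hA')
    rw [segment_symm]
    intro hh
    exact this (segment_subset_convexHull_left hh)
  have h2 : crossNumber P P' A (P - R.r • (P' - P)) = 0 := by
    rcases lt_or_ge (signedArea P P' A) 0 with hu | hu
    · rw [crossNumber_of_neg_of_nonneg hu R.signedArea_back.ge, if_neg]
      have : signedArea A (P - R.r • (P' - P)) P = R.r * signedArea P P' A := by
        simp only [signedArea, PiLp.smul_apply, PiLp.sub_apply, smul_eq_mul]; ring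
      rw [this]
      exact not_lt.2 (mul_neg_of_pos_of_neg R.r_pos hu).le
    · exact crossNumber_eq_zero hu R.signedArea_back.ge
  have h3 := Route.edge (v := v) (hN _ _ hA R.back_mem h1) (hS _ hA hA')
    (hS _ R.back_mem (R.back_not_mem_ray hP))
  rwa [hv _ _ hA R.back_mem, h2, zpow_zero] at h3

/-- The triangular loop from the back point through `Y` and `Y'`: its edges have crossing numbers 0,
1 and 0. -/
theorem Reference.route_around (hP : P' ≠ P) (R : Reference P P' K)
    (hN : ∀ A B, A ∈ K → B ∈ K → P ∉ segment ℝ A B → segment ℝ A B ⊆ N)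
    (hS : ∀ A ∈ K, A ∉ ray P P' → A ∈ S)
    (hv : ∀ A B, A ∈ K → B ∈ K → v A B = γ ^ crossNumber P P' A B) :
    Route N S v (P - R.r • (P' - P)) (P - R.r • (P' - P)) γ := by
  have hZ := R.back_mem
  have hZS := hS _ hZ (R.back_not_mem_ray hP)
  have hYS := hS _ R.Y_mem R.Y_not_mem_ray
  have hYS' := hS _ R.Y'_mem R.Y'_not_mem_ray
  have hZP : P - R.r • (P' - P) ≠ P := by
    intro h
    exact R.back_not_mem_ray hP (by rw [h]; exact origin_mem_ray P P')
  have e1 := Route.edge (v := v) (hN _ _ hZ R.Y_mem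
    (not_mem_segment_of_pos R.Y_pos R.signedArea_back.ge hZP)) hZS hYS
  have e2 := Route.edge (v := v) (hN _ _ R.Y_mem R.Y'_mem
    fun h => R.crosses.ne (signedArea_eq_zero_of_mem_segment h)) hYS hYS'
  have e3 := Route.edge (v := v) (hN _ _ R.Y'_mem hZ
    fun h => R.not_crosses.ne (signedArea_eq_zero_of_mem_segment h)) hYS' hZS
  rw [hv _ _ hZ R.Y_mem, crossNumber_eq_zero R.signedArea_back.ge R.Y_pos.le] at e1
  rw [hv _ _ R.Y_mem R.Y'_mem, crossNumber_of_nonneg_of_neg R.Y_pos.le R.Y'_neg,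
    if_pos R.crosses] at e2
  rw [hv _ _ R.Y'_mem hZ, crossNumber_of_neg_of_nonneg R.Y'_neg R.signedArea_back.ge,
    if_neg (not_lt.2 R.not_crosses.le)] at e3
  simpa using (e1.trans e2).trans e3

end

/-! ### Homotopy of lists of points -/

/-- The elementary cancellations, for arbitrary lists of points. -/
def ListCancels (N : Set Plane) (m m' : List Plane) : Prop :=
  ∃ (L R : List Plane) (A B C : Plane), m = L ++ A :: B :: C :: R ∧ m' = L ++ A :: C :: R ∧
    convexHull ℝ ({A, B, C} : Set Plane) ⊆ N

/-- The equivalence relation generated by the elementary cancellations. -/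
def ListHomotopic (N : Set Plane) : List Plane → List Plane → Prop :=
  Relation.EqvGen (ListCancels N)

section
variable {N : Set Plane} {X : N} {A B C : Plane} {m m' m₁ m₂ m₃ : List Plane}

theorem ListHomotopic.refl (m : List Plane) : ListHomotopic N m m := Relation.EqvGen.refl _

theorem ListHomotopic.trans (h : ListHomotopic N m₁ m₂) (h' : ListHomotopic N m₂ m₃) :
    ListHomotopic N m₁ m₃ := Relation.EqvGen.trans _ _ _ h h'

theorem ListHomotopic.append (h : ListHomotopic N m m') (L R : List Plane) :
    ListHomotopic N (L ++ m ++ R) (L ++ m' ++ R) := by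
  induction h with
  | rel _ _ h =>
    obtain ⟨L', R', A, B, C, rfl, rfl, h⟩ := h
    exact .rel _ _ ⟨L ++ L', R' ++ R, A, B, C, by simp, by simp, h⟩
  | refl _ => exact .refl _
  | symm _ _ _ ih => exact .symm _ _ ih
  | trans _ _ _ _ _ ih₁ ih₂ => exact Relation.EqvGen.trans _ _ _ ih₁ ih₂

theorem ListHomotopic.cancel (h : convexHull ℝ ({A, B, C} : Set Plane) ⊆ N) :
    ListHomotopic N [A, B, C] [A, C] :=
  .rel _ _ ⟨[], [], A, B, C, rfl, rfl, h⟩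

theorem ListHomotopic.dup_left (h : segment ℝ A C ⊆ N) : ListHomotopic N [A, A, C] [A, C] :=
  .cancel (by simpa [convexHull_pair] using h)

theorem ListHomotopic.dup_right (h : segment ℝ A C ⊆ N) : ListHomotopic N [A, C, C] [A, C] :=
  .cancel (by simpa [convexHull_pair] using h)

theorem ListHomotopic.backtrack (h : segment ℝ A B ⊆ N) : ListHomotopic N [A, B, A] [A, A] := by
  refine .cancel ?_
  have : ({A, B, A} : Set Plane) = {A, B} := by ext; simp; tauto
  rwa [this, convexHull_pair]

/-- The excursion collapses from its far end. The result is `[A, A]` and not `[A]`, because a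
cancellation never removes an end of the list. -/
theorem ListHomotopic.retrace (A : Plane) (p : List Plane)
    (h : (A :: p).IsChain fun A B => segment ℝ A B ⊆ N) :
    ListHomotopic N (A :: p ++ (A :: p).reverse) [A, A] := by
  induction p generalizing A with
  | nil => exact .refl _
  | cons B p ih =>
    rw [List.isChain_cons_cons] at h
    have h1 := (ih B h.2).append [A] [A]
    have h2 := (ListHomotopic.dup_right h.1).append [] [A]
    have h3 := ListHomotopic.backtrack h.1
    simp only [List.cons_append, List.nil_append, List.append_assoc, List.reverse_cons] at h1 h2 ⊢
    exact (h1.trans h2).trans h3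

theorem ListCancels.isChain_iff (h : ListCancels N m m') :
    m.IsChain (fun A B => segment ℝ A B ⊆ N) ↔ m'.IsChain (fun A B => segment ℝ A B ⊆ N) := by
  obtain ⟨L, R, A, B, C, rfl, rfl, h⟩ := h
  have h1 := segment_subset_convexHull_left.trans h
  have h2 := segment_subset_convexHull_right.trans h
  have h3 := segment_subset_convexHull_outer.trans h
  rw [List.isChain_split, List.isChain_split (l₁ := L) (c := A) (l₂ := C :: R)]
  simp only [List.isChain_cons_cons, h1, h2, h3, true_and]

theorem exists_path_eq_iff : (∃ l : BasedLine N X, l.path = m) ↔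
    m.IsChain (fun A B => segment ℝ A B ⊆ N) ∧ m.head? = some (X : Plane) ∧
      m.tail.getLast? = some (X : Plane) := by
  constructor
  · rintro ⟨l, rfl⟩
    exact ⟨l.segment_subset, rfl, by simp [BasedLine.path]⟩
  · rintro ⟨h1, h2, h3⟩
    cases m with
    | nil => simp at h2
    | cons Y m =>
      obtain rfl : Y = (X : Plane) := by simpa using h2
      obtain ⟨t, rfl⟩ := List.getLast?_eq_some_iff.1 h3
      exact ⟨⟨t, h1⟩, rfl⟩

/-- A cancellation preserves the chain condition and both ends, so a list homotopy starting at a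
based line stays among based lines. -/
theorem ListCancels.exists_path_iff (h : ListCancels N m m') :
    (∃ l : BasedLine N X, l.path = m) ↔ ∃ l : BasedLine N X, l.path = m' := by
  rw [exists_path_eq_iff, exists_path_eq_iff, h.isChain_iff]
  obtain ⟨L, R, A, B, C, rfl, rfl, -⟩ := h
  cases L <;> simp

theorem BasedLine.path_injective {l l' : BasedLine N X} (h : l.path = l'.path) : l = l' := by
  ext1
  simpa [path] using h

open Classical in
/-- The based homotopy class of a list of points (the identity if it is not a based line). -/
noncomputable def listClass (X : N) (m : List Plane) : LoopClass N X :=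
  if h : ∃ l : BasedLine N X, l.path = m then LoopClass.mk h.choose else 1

theorem listClass_path (l : BasedLine N X) : listClass X l.path = LoopClass.mk l := by
  have h : ∃ l' : BasedLine N X, l'.path = l.path := ⟨l, rfl⟩
  rw [listClass, dif_pos h, BasedLine.path_injective h.choose_spec]

theorem ListHomotopic.listClass_eq (h : ListHomotopic N m m') : listClass X m = listClass X m' := by
  induction h with
  | rel m m' h =>
    by_cases hm : ∃ l : BasedLine N X, l.path = m
    · obtain ⟨l', rfl⟩ := h.exists_path_iff.1 hm
      obtain ⟨l, rfl⟩ := hm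
      rw [listClass_path, listClass_path]
      exact LoopClass.mk_eq (.rel _ _ h)
    · rw [listClass, listClass, dif_neg hm, dif_neg (h.exists_path_iff.not.1 hm)]
  | refl _ => rfl
  | symm _ _ _ ih => exact ih.symm
  | trans _ _ _ _ _ ih₁ ih₂ => exact ih₁.trans ih₂

/-- The concatenation has `X` twice at the joint, the product of lines only once; the duplicate is
cancelled. -/
theorem listClass_append (hm : ∃ l : BasedLine N X, l.path = m)
    (hm' : ∃ l : BasedLine N X, l.path = m') :
    listClass X (m ++ m') = listClass X m * listClass X m' := by
  obtain ⟨l, rfl⟩ := hm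
  obtain ⟨l', rfl⟩ := hm'
  rw [listClass_path, listClass_path, LoopClass.mk_mul, ← listClass_path]
  obtain ⟨C, R, hC⟩ : ∃ C R, l'.tail ++ [(X : Plane)] = C :: R :=
    List.exists_cons_of_ne_nil (by simp)
  have hXC : segment ℝ (X : Plane) C ⊆ N := by
    have h := l'.segment_subset
    rw [hC, List.isChain_cons_cons] at h
    exact h.1
  have := (ListHomotopic.dup_left hXC).append ((X : Plane) :: l.tail) R
  have := this.listClass_eq (X := X)
  simpa [BasedLine.path, BasedLine.mul, hC] using this

end

/-! ### The tautological cocycle -/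

/-- A choice of polygonal paths `X, p A` in `N` from the basepoint to the points `A`. -/
structure PathChoice {N : Set Plane} (X : N) where
  p : Plane → List Plane
  isChain : ∀ A ∈ N, ((X : Plane) :: p A).IsChain fun A B => segment ℝ A B ⊆ N
  getLast : ∀ A ∈ N, ((X : Plane) :: p A).getLast? = some A
  base : p X = []

namespace PathChoice

variable {N : Set Plane} {X : N} (c : PathChoice X) {A B C : Plane}

/-- The class of the closed line that follows the chosen path to `A`, the edge `AB` and the chosen
path from `B` back to the basepoint. -/
noncomputable def cocycle (A B : Plane) : LoopClass N X :=
  listClass X ((X : Plane) :: c.p A ++ ((X : Plane) :: c.p B).reverse)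

theorem exists_path (m : List Plane) (hA : A ∈ N) (hB : B ∈ N)
    (hm : (A :: m).IsChain fun A B => segment ℝ A B ⊆ N)
    (hmB : ∀ Y, (A :: m).getLast? = some Y → segment ℝ Y B ⊆ N) :
    ∃ l : BasedLine N X,
      l.path = (X : Plane) :: c.p A ++ (m ++ ((X : Plane) :: c.p B).reverse) := by
  rw [exists_path_eq_iff]
  refine ⟨?_, by simp, by simp⟩
  obtain ⟨a, ha⟩ := List.getLast?_eq_some_iff.1 (c.getLast A hA)
  obtain ⟨b, hb⟩ := List.getLast?_eq_some_iff.1 (c.getLast B hB)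
  have hAc := c.isChain A hA
  have hBc := BasedLine.isChain_reverse (c.isChain B hB)
  rw [ha] at hAc ⊢
  rw [hb] at hBc ⊢
  have h1 : (A :: m ++ (b ++ [B]).reverse).IsChain fun A B => segment ℝ A B ⊆ N := by
    rw [List.isChain_append]
    refine ⟨hm, hBc, ?_⟩
    intro Y hY Z hZ
    obtain rfl : B = Z := by simpa using hZ
    exact hmB Y hY
  have := List.isChain_split.2 ⟨hAc, h1⟩
  simpa using this

theorem retrace (hA : A ∈ N) :
    ListHomotopic N (((X : Plane) :: c.p A).reverse ++ (X : Plane) :: c.p A) [A, A] := by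
  obtain ⟨a, ha⟩ := List.getLast?_eq_some_iff.1 (c.getLast A hA)
  have h := BasedLine.isChain_reverse (c.isChain A hA)
  rw [ha] at h ⊢
  rw [List.reverse_append, List.reverse_singleton, List.singleton_append] at h ⊢
  simpa using ListHomotopic.retrace A a.reverse h

/-- In the concatenated loop the path from `B` to the basepoint and back retraces to `[B, B]`. What
remains between the paths of `A` and `C` is `A, B, B, C`, which the triangle reduces to `A, C`. -/
theorem cocycle_mul (h : convexHull ℝ ({A, B, C} : Set Plane) ⊆ N) :
    c.cocycle A B * c.cocycle B C = c.cocycle A C := by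
  have h1 := segment_subset_convexHull_left.trans h
  have h2 := segment_subset_convexHull_right.trans h
  have hA := h1 (left_mem_segment ℝ A B)
  have hB := h1 (right_mem_segment ℝ A B)
  have hC := h2 (right_mem_segment ℝ B C)
  have e1 := c.exists_path (X := X) (A := A) (B := B) [] hA hB (by simp)
    (by rintro Y hY; obtain rfl : A = Y := by simpa using hY
        exact h1)
  have e2 := c.exists_path (X := X) (A := B) (B := C) [] hB hC (by simp)
    (by rintro Y hY; obtain rfl : B = Y := by simpa using hY
        exact h2)
  rw [List.nil_append] at e1 e2
  unfold cocycle
  rw [← listClass_append e1 e2]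
  apply ListHomotopic.listClass_eq
  have r := (c.retrace hB).append ((X : Plane) :: c.p A) ((X : Plane) :: c.p C).reverse
  obtain ⟨a, ha⟩ := List.getLast?_eq_some_iff.1 (c.getLast A hA)
  obtain ⟨d, hd⟩ := List.getLast?_eq_some_iff.1 (c.getLast C hC)
  have r' := (((ListHomotopic.dup_right h1).append [] [C]).trans (.cancel h)).append a d.reverse
  have e3 : a ++ ([] ++ [A, B, B] ++ [C]) ++ d.reverse =
      (X : Plane) :: c.p A ++ [B, B] ++ ((X : Plane) :: c.p C).reverse := by
    rw [ha, hd]; simp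
  have e4 : a ++ [A, C] ++ d.reverse =
      (X : Plane) :: c.p A ++ ((X : Plane) :: c.p C).reverse := by
    rw [ha, hd]; simp
  rw [e3, e4] at r'
  have r'' := r.trans r'
  simpa only [List.append_assoc] using r''

/-- Inserting at each vertex an excursion to the basepoint and back cuts the loop into the loops of
the cocycle, one for each edge. -/
theorem listClass_eq_listProd (m : List Plane) (A B : Plane)
    (hm : (A :: m).IsChain fun A B => segment ℝ A B ⊆ N) (hA : A ∈ N) (hB : B ∈ N)
    (hmB : (A :: m).getLast? = some B) :
    listClass X ((X : Plane) :: c.p A ++ (m ++ ((X : Plane) :: c.p B).reverse)) =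
      listProd c.cocycle (A :: m) := by
  induction m generalizing A with
  | nil =>
    obtain rfl : A = B := by simpa using hmB
    rw [List.nil_append, (ListHomotopic.retrace _ _ (c.isChain A hA)).listClass_eq]
    exact listClass_path (BasedLine.point N X)
  | cons C m ih =>
    have hm' := hm
    rw [List.isChain_cons_cons] at hm'
    have hC : C ∈ N := hm'.1 (right_mem_segment ℝ A C)
    have hmC : (C :: m).getLast? = some B := by simpa using hmB
    have hBB : segment ℝ B B ⊆ N := by simpa using hB
    simp only [listProd]
    rw [← ih C hm'.2 hC hmC, cocycle]
    have e1 := c.exists_path (X := X) (A := A) (B := C) [] hA hC (by simp)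
      (by rintro Y hY; obtain rfl : A = Y := by simpa using hY
          exact hm'.1)
    have e2 := c.exists_path (X := X) (A := C) (B := B) m hC hB hm'.2
      (by rintro Y hY; obtain rfl : B = Y := by simpa [hmC] using hY
          exact hBB)
    rw [List.nil_append] at e1
    rw [← listClass_append e1 e2]
    symm
    apply ListHomotopic.listClass_eq
    have r := (c.retrace hC).append ((X : Plane) :: c.p A)
      (m ++ ((X : Plane) :: c.p B).reverse)
    obtain ⟨D, R, hD⟩ : ∃ D R, m ++ ((X : Plane) :: c.p B).reverse = D :: R :=
      List.exists_cons_of_ne_nil (by simp)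
    have hCD : segment ℝ C D ⊆ N := by
      have : (C :: m ++ ((X : Plane) :: c.p B).reverse).IsChain
          fun A B => segment ℝ A B ⊆ N := by
        rw [List.isChain_append]
        refine ⟨hm'.2, BasedLine.isChain_reverse (c.isChain B hB), ?_⟩
        intro Y hY Z hZ
        rw [List.head?_reverse, c.getLast B hB] at hZ
        obtain rfl : B = Z := by simpa using hZ
        obtain rfl : B = Y := by simpa [hmC] using hY
        exact hBB
      rw [List.cons_append, hD, List.isChain_cons_cons] at this
      exact this.1
    have r' := (ListHomotopic.dup_left hCD).append ((X : Plane) :: c.p A) R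
    rw [List.cons_append (a := C), hD]
    rw [hD] at r
    have r'' : ListHomotopic N ((X : Plane) :: c.p A ++ [C, C] ++ D :: R)
        ((X : Plane) :: c.p A ++ C :: D :: R) := by simpa using r'
    simpa only [List.append_assoc] using r.trans r''

/-- The case `A = B = X`. Since the chosen path to `X` is empty, no conjugation appears; there is
only a repeated final `X` to cancel. -/
theorem mk_eq_listProd (l : BasedLine N X) : LoopClass.mk l = listProd c.cocycle l.path := by
  have h := c.listClass_eq_listProd (l.tail ++ [(X : Plane)]) X X l.segment_subset X.2 X.2
    (by rw [← List.cons_append, List.getLast?_append]; rfl)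
  rw [c.base] at h
  rw [BasedLine.path, ← h, ← listClass_path]
  symm
  apply ListHomotopic.listClass_eq
  obtain ⟨L, D, hD⟩ : ∃ L D, (X : Plane) :: l.tail = L ++ [D] :=
    ⟨_, _, (List.dropLast_append_getLast (by simp)).symm⟩
  have hc := l.segment_subset
  rw [← List.cons_append, hD, List.append_assoc, List.singleton_append, List.isChain_split] at hc
  have r := (ListHomotopic.dup_right (by simpa using hc.2 : segment ℝ D (X : Plane) ⊆ N)).append L []
  have e1 : L ++ [D, X, X] ++ [] = (X : Plane) :: l.tail ++ [(X : Plane), (X : Plane)] := by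
    rw [hD]; simp
  have e2 : L ++ [D, X] ++ [] = (X : Plane) :: l.tail ++ [(X : Plane)] := by rw [hD]; simp
  rw [e1, e2] at r
  simpa [BasedLine.path] using r

end PathChoice
/-! ### The isomorphism -/

section
variable {f : Plane →ₗ[ℝ] ℝ} {s : ℝ} {P P' Q Q' : Plane}

theorem Separates.segment_subset_left (hs : Separates f s P P' Q Q') {A B : Plane} (hA : f A ≤ s)
    (hB : f B ≤ s) (h : P ∉ segment ℝ A B) : segment ℝ A B ⊆ ({P, Q}ᶜ : Set Plane) := by
  intro V hV
  rintro (rfl | rfl)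
  · exact h hV
  · exact absurd ((convex_le f s).segment_subset hA hB hV : f V ≤ s)
      (not_le.2 (hs.2 V (origin_mem_ray V Q')))

theorem Separates.segment_subset_right (hs : Separates f s P P' Q Q') {A B : Plane} (hA : s ≤ f A)
    (hB : s ≤ f B) (h : Q ∉ segment ℝ A B) : segment ℝ A B ⊆ ({P, Q}ᶜ : Set Plane) := by
  intro V hV
  rintro (rfl | rfl)
  · exact absurd ((convex_ge f s).segment_subset hA hB hV : s ≤ f V)
      (not_le.2 (hs.1 V (origin_mem_ray V P')))
  · exact h hV

/-- The complement of the rays. -/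
def offRays (P P' Q Q' : Plane) : Set Plane := {V | V ∉ ray P P' ∧ V ∉ ray Q Q'}

/-- Any two points off the rays are joined by a path off the rays with trivial value, and every
value is realized by a loop. -/
theorem Separates.exists_routes (hs : Separates f s P P' Q Q') (hP : P' ≠ P) (hQ : Q' ≠ Q) :
    (∀ A ∈ offRays P P' Q Q', ∀ B ∈ offRays P P' Q Q',
      Route {P, Q}ᶜ (offRays P P' Q Q') (segVal f P P' Q Q') A B 1) ∧
    ∀ A ∈ offRays P P' Q Q', ∀ w,
      Route {P, Q}ᶜ (offRays P P' Q Q') (segVal f P P' Q Q') A A w := by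
  obtain ⟨R⟩ := hs.nonempty_reference_left hP
  obtain ⟨T⟩ := hs.nonempty_reference_right hQ
  have hPs := hs.1 P (origin_mem_ray P P')
  have hQs := hs.2 Q (origin_mem_ray Q Q')
  have hsw : ∀ A B, segVal f P P' Q Q' B A = (segVal f P P' Q Q' A B)⁻¹ :=
    fun A B => hs.segVal_swap
  have NP : ∀ A B, A ∈ {Z | f Z ≤ s} → B ∈ {Z | f Z ≤ s} → P ∉ segment ℝ A B →
    segment ℝ A B ⊆ ({P, Q}ᶜ : Set Plane) := fun A B hA hB h => hs.segment_subset_left hA hB h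
  have NQ : ∀ A B, A ∈ {Z | s ≤ f Z} → B ∈ {Z | s ≤ f Z} → Q ∉ segment ℝ A B →
    segment ℝ A B ⊆ ({P, Q}ᶜ : Set Plane) := fun A B hA hB h => hs.segment_subset_right hA hB h
  have SP : ∀ A ∈ {Z | f Z ≤ s}, A ∉ ray P P' → A ∈ offRays P P' Q Q' := fun A hA h =>
    ⟨h, fun h' => not_lt.2 hA (hs.2 A h')⟩
  have SQ : ∀ A ∈ {Z | s ≤ f Z}, A ∉ ray Q Q' → A ∈ offRays P P' Q Q' := fun A hA h =>
    ⟨fun h' => not_lt.2 hA (hs.1 A h'), h⟩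
  have VP : ∀ A B, A ∈ {Z | f Z ≤ s} → B ∈ {Z | f Z ≤ s} →
    segVal f P P' Q Q' A B = FreeGroup.of 0 ^ crossNumber P P' A B :=
    fun A B hA hB => hs.segVal_left hA hB
  have VQ : ∀ A B, A ∈ {Z | s ≤ f Z} → B ∈ {Z | s ≤ f Z} →
    segVal f P P' Q Q' A B = FreeGroup.of 1 ^ crossNumber Q Q' A B :=
    fun A B hA hB => hs.segVal_right hA hB
  obtain ⟨O, hO⟩ := exists_apply_eq (hPs.trans hQs) s
  have toP := fun A hA hA' => R.route_to_back (A := A) hP NP SP VP hA hA'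
  have toQ := fun A hA hA' => T.route_to_back (A := A) hQ NQ SQ VQ hA hA'
  have OP := toP O hO.le fun h => (hs.1 O h).ne hO
  have OQ := toQ O hO.ge fun h => (hs.2 O h).ne' hO
  -- Every point lies in one of the two closed half-planes and `O` lies in both, so the back point
  -- of that half-plane joins the point to `O`.
  have toO : ∀ A ∈ offRays P P' Q Q',
      Route {P, Q}ᶜ (offRays P P' Q Q') (segVal f P P' Q Q') A O 1 := by
    intro A hA
    rcases le_total (f A) s with h | h
    · simpa using (toP A h hA.1).trans (OP.symm hsw)
    · simpa using (toQ A h hA.2).trans (OQ.symm hsw)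
  have conn : ∀ A ∈ offRays P P' Q Q', ∀ B ∈ offRays P P' Q Q',
      Route {P, Q}ᶜ (offRays P P' Q Q') (segVal f P P' Q Q') A B 1 := by
    intro A hA B hB
    simpa using (toO A hA).trans ((toO B hB).symm hsw)
  refine ⟨conn, fun A hA w => ?_⟩
  have hgen : ∀ i : Fin 2, Route {P, Q}ᶜ (offRays P P' Q Q') (segVal f P P' Q Q') A A
      (FreeGroup.of i) := by
    intro i
    fin_cases i
    · have h1 := conn A hA _ (SP _ R.back_mem (R.back_not_mem_ray hP))
      simpa using (h1.trans (R.route_around hP NP SP VP)).trans (h1.symm hsw)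
    · have h1 := conn A hA _ (SQ _ T.back_mem (T.back_not_mem_ray hQ))
      simpa using (h1.trans (T.route_around hQ NQ SQ VQ)).trans (h1.symm hsw)
  induction w using FreeGroup.induction_on with
  | C1 => exact conn A hA A hA
  | of i => exact hgen i
  | inv_of i _ => exact (hgen i).symm hsw
  | mul x y hx hy => exact hx.trans hy

/-- Points off the rays are reached by `exists_routes`. A point on a ray, other than its origin, is
joined by a segment to the reference point `Y` on the left, which is off the rays. -/
theorem Separates.nonempty_pathChoice (hs : Separates f s P P' Q Q') (hP : P' ≠ P) (hQ : Q' ≠ Q)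
    {X : ({P, Q}ᶜ : Set Plane)} (hX : (X : Plane) ∈ offRays P P' Q Q') :
    Nonempty (PathChoice X) := by
  have conn := (hs.exists_routes hP hQ).1 X hX
  have off : ∀ A ∈ offRays P P' Q Q', ∃ p : List Plane, ((X : Plane) :: (p ++ [A])).IsChain
      fun A B => segment ℝ A B ⊆ ({P, Q}ᶜ : Set Plane) := by
    intro A hA
    obtain ⟨t, ht, -⟩ := conn A hA
    exact ⟨t, ht⟩
  have extend : ∀ Y A, Y ∈ offRays P P' Q Q' → segment ℝ Y A ⊆ ({P, Q}ᶜ : Set Plane) →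
      ∃ p : List Plane, ((X : Plane) :: (p ++ [A])).IsChain
        fun A B => segment ℝ A B ⊆ ({P, Q}ᶜ : Set Plane) := by
    intro Y A hY hYA
    obtain ⟨p, hp⟩ := off Y hY
    refine ⟨p ++ [Y], ?_⟩
    have := List.isChain_split (l₁ := (X : Plane) :: p) (c := Y) (l₂ := [A]).2
      ⟨hp, by simpa using hYA⟩
    simpa using this
  have all : ∀ A ∈ ({P, Q}ᶜ : Set Plane), ∃ p : List Plane, ((X : Plane) :: (p ++ [A])).IsChain
      fun A B => segment ℝ A B ⊆ ({P, Q}ᶜ : Set Plane) := by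
    intro A hA
    by_cases hAP : A ∈ ray P P'
    · obtain ⟨R⟩ := hs.nonempty_reference_left hP
      have hAP' : A ≠ P := fun h => hA (by simp [h])
      have hA0 : signedArea P P' A = 0 := by
        obtain ⟨t, -, rfl⟩ := hAP; exact signedArea_ray P P' t
      refine extend R.Y A ⟨R.Y_not_mem_ray, fun h' => not_lt.2 R.Y_mem (hs.2 _ h')⟩
        (hs.segment_subset_left R.Y_mem (hs.1 A hAP).le ?_)
      rw [segment_symm]
      exact not_mem_segment_of_pos R.Y_pos hA0.ge hAP'
    by_cases hAQ : A ∈ ray Q Q'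
    · obtain ⟨R⟩ := hs.nonempty_reference_right hQ
      have hAQ' : A ≠ Q := fun h => hA (by simp [h])
      have hA0 : signedArea Q Q' A = 0 := by
        obtain ⟨t, -, rfl⟩ := hAQ; exact signedArea_ray Q Q' t
      refine extend R.Y A ⟨fun h' => not_lt.2 R.Y_mem (hs.1 _ h'), R.Y_not_mem_ray⟩
        (hs.segment_subset_right R.Y_mem (hs.2 A hAQ).le ?_)
      rw [segment_symm]
      exact not_mem_segment_of_pos R.Y_pos hA0.ge hAQ'
    exact off A ⟨hAP, hAQ⟩
  classical
  choose! q hq using all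
  refine ⟨⟨fun A => if A = X then [] else q A ++ [A], fun A hA => ?_, fun A hA => ?_, if_pos rfl⟩⟩
  · split_ifs with h
    · simp
    · exact hq A hA
  · split_ifs with h
    · simp [h]
    · rw [← List.cons_append, List.getLast?_append]; rfl

/-- The homomorphism to the free group. -/
noncomputable def valueHom (hs : Separates f s P P' Q Q') (X : ({P, Q}ᶜ : Set Plane)) :
    LoopClass {P, Q}ᶜ X →* FreeGroup (Fin 2) :=
  MonoidHom.mk'
    (Quotient.lift (fun l : BasedLine {P, Q}ᶜ X => listProd (segVal f P P' Q Q') l.path) (by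
      intro l l' h
      induction (h : BasedLine.Homotopic l l') with
      | rel l l' h =>
        obtain ⟨L, R, A, B, C, e, e', h⟩ := h
        rw [e, e', listProd_cancel _ (hs.segVal_mul h)]
      | refl _ => rfl
      | symm _ _ _ ih => exact ih.symm
      | trans _ _ _ _ _ ih₁ ih₂ => exact ih₁.trans ih₂))
    (by
      rintro ⟨l⟩ ⟨l'⟩
      have := listProd_append (segVal f P P' Q Q') ((X : Plane) :: l.tail) X
        (l'.tail ++ [(X : Plane)])
      change listProd _ (BasedLine.mul l l').path = listProd _ l.path * listProd _ l'.path
      simpa [BasedLine.path, BasedLine.mul] using this)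

theorem valueHom_mk (hs : Separates f s P P' Q Q') {X : ({P, Q}ᶜ : Set Plane)}
    (l : BasedLine {P, Q}ᶜ X) :
    valueHom hs X (LoopClass.mk l) = listProd (segVal f P P' Q Q') l.path := rfl

/-- Universality applied to the tautological cocycle expresses the class of a loop through its
value: `w ↦ (h X)⁻¹ * ψ w * h X` is a left inverse. -/
theorem valueHom_injective (hs : Separates f s P P' Q Q') (hP : P' ≠ P) (hQ : Q' ≠ Q)
    {X : ({P, Q}ᶜ : Set Plane)} (hX : (X : Plane) ∈ offRays P P' Q Q') :
    Function.Injective (valueHom hs X) := by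
  obtain ⟨c⟩ := hs.nonempty_pathChoice hP hQ hX
  obtain ⟨ψ, h, hψ⟩ := exists_hom_of_cocycle hs hP hQ fun A B C => c.cocycle_mul
  refine Function.LeftInverse.injective (g := fun w => (h X)⁻¹ * ψ w * h X) ?_
  rintro ⟨l⟩
  change (h X)⁻¹ * ψ (valueHom hs X (LoopClass.mk l)) * h X = LoopClass.mk l
  rw [valueHom_mk, c.mk_eq_listProd l]
  exact (listProd_coboundary hψ X X _ l.segment_subset
    (by rw [← List.cons_append, List.getLast?_append]; rfl)).symm

theorem exists_generalPosition_valueHom (hs : Separates f s P P' Q Q') (hP : P' ≠ P) (hQ : Q' ≠ Q)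
    {X : ({P, Q}ᶜ : Set Plane)} (hX : (X : Plane) ∈ offRays P P' Q Q') (w : FreeGroup (Fin 2)) :
    ∃ l : BasedLine {P, Q}ᶜ X, l.GeneralPosition P P' Q Q' ∧
      valueHom hs X (LoopClass.mk l) = w := by
  obtain ⟨t, ht, hS, rfl⟩ := (hs.exists_routes hP hQ).2 X hX w
  refine ⟨⟨t, ht⟩, fun V hV => hS V ?_, rfl⟩
  simp only [BasedLine.vertices, List.mem_cons, List.mem_append] at hV ⊢
  tauto

theorem valueHom_of_generalPosition (hs : Separates f s P P' Q Q') (hP : P' ≠ P) (hQ : Q' ≠ Q)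
    {X : ({P, Q}ᶜ : Set Plane)} {l : BasedLine {P, Q}ᶜ X} (hl : l.GeneralPosition P P' Q Q') :
    valueHom hs X (LoopClass.mk l) = FreeGroup.mk (l.poincareWord P P' Q Q') := by
  rw [valueHom_mk, BasedLine.poincareWord]
  refine (hs.mk_pathWord hP hQ l.path l.segment_subset fun V hV => hl V ?_).symm
  simp only [BasedLine.path, BasedLine.vertices, List.mem_cons, List.mem_append] at hV ⊢
  simp only [List.not_mem_nil] at hV
  tauto

end
end PlaneLoops

theorem proposition8p9 (P P' Q Q' : PlaneLoops.Plane) (hP : P' ≠ P) (hQ : Q' ≠ Q)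
    (hdisj : Disjoint (PlaneLoops.ray P P') (PlaneLoops.ray Q Q'))
    (X : ({P, Q}ᶜ : Set PlaneLoops.Plane))
    (hXP : (X : PlaneLoops.Plane) ∉ PlaneLoops.ray P P')
    (hXQ : (X : PlaneLoops.Plane) ∉ PlaneLoops.ray Q Q') :
    (∀ l : PlaneLoops.BasedLine {P, Q}ᶜ X, ∃ l' : PlaneLoops.BasedLine {P, Q}ᶜ X,
      l.Homotopic l' ∧ l'.GeneralPosition P P' Q Q') ∧
    ∃! φ : PlaneLoops.LoopClass {P, Q}ᶜ X ≃* FreeGroup (Fin 2),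
      ∀ l : PlaneLoops.BasedLine {P, Q}ᶜ X, l.GeneralPosition P P' Q Q' →
        φ (PlaneLoops.LoopClass.mk l) = FreeGroup.mk (l.poincareWord P P' Q Q') := by
  obtain ⟨f, s, hs⟩ := PlaneLoops.exists_separates hP hdisj
  have hX : (X : PlaneLoops.Plane) ∈ PlaneLoops.offRays P P' Q Q' := ⟨hXP, hXQ⟩
  have inj := PlaneLoops.valueHom_injective hs hP hQ hX
  have hex := PlaneLoops.exists_generalPosition_valueHom hs hP hQ hX
  -- A line in general position with the same value exists by `hex`, and injectivity makes it
  -- homotopic to `l`.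
  have gp : ∀ l : PlaneLoops.BasedLine {P, Q}ᶜ X, ∃ l' : PlaneLoops.BasedLine {P, Q}ᶜ X,
      l.Homotopic l' ∧ l'.GeneralPosition P P' Q Q' := by
    intro l
    obtain ⟨l', hl', e⟩ := hex (PlaneLoops.valueHom hs X (PlaneLoops.LoopClass.mk l))
    exact ⟨l', Quotient.exact (s := PlaneLoops.BasedLine.homotopySetoid _ X) (inj e.symm), hl'⟩
  refine ⟨gp, MulEquiv.ofBijective (PlaneLoops.valueHom hs X) ⟨inj, fun w => ?_⟩, fun l hl => ?_,
    fun φ hφ => ?_⟩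
  · obtain ⟨l, -, e⟩ := hex w
    exact ⟨_, e⟩
  · exact PlaneLoops.valueHom_of_generalPosition hs hP hQ hl
  -- Uniqueness: every class has a representative in general position, on which the value of `φ` is
  -- prescribed.
  · ext1 x
    obtain ⟨l, rfl⟩ : ∃ l, PlaneLoops.LoopClass.mk l = x := Quotient.exists_rep x
    obtain ⟨l', h, hl'⟩ := gp l
    rw [PlaneLoops.LoopClass.mk_eq h, hφ l' hl']
    exact (PlaneLoops.valueHom_of_generalPosition hs hP hQ hl').symm
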